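/- Let $B_\infty^+$ and $B_\infty$ be the monoid and the group generated by $\sigma_1,\sigma_2,\dots$ subject to $\sigma_i\sigma_j=\sigma_j\sigma_i$ for $|i-j|\ge 2$ and $\sigma_i\sigma_j\sigma_i=\sigma_j\sigma_i\sigma_j$ for $|i-j|=1$. For $x,y$ in $B_\infty^+$ (mapped to $B_\infty$), write $x<y$ if $x^{-1}y$ is represented by a word in the letters $\sigma_i^{\pm1}$ that is $\sigma$-positive, i.e. for some $m$ the word contains $\sigma_m$, does not contain $\sigma_m^{-1}$, and contains no $\sigma_i^{\pm1}$ with $i>m$. For $z\in B_\infty^+$ let $\mathrm{Div}(z)$ be the set of left divisors of $z$ in $B_\infty^+$, and let $\Delta_3=\sigma_1\sigma_2\sigma_1$. For $p\ge 0$ let $\delta_{3,p}$ be the braid represented by the length $p$ suffix of the left infinite periodic word $\cdots\sigma_2\sigma_1\sigma_1\sigma_2\,\sigma_2\sigma_1\sigma_1\sigma_2$ (so $\delta_{3,0}=1$, $\delta_{3,1}=\sigma_2$, $\delta_{3,2}=\sigma_1\sigma_2$, $\delta_{3,3}=\sigma_1\sigma_1\sigma_2$, $\delta_{3,4}=\sigma_2\sigma_1\sigma_1\sigma_2$).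 For finite sequences of positive braids, $+$ denotes concatenation, and $xS$ denotes the sequence obtained from $S$ by multiplying each entry by $x$ on the left. Put $S_2^d=(1,\sigma_1,\sigma_1^2,\dots,\sigma_1^d)$. **Proposition 4.7.** For $d\ge 0$ define $$S_3^d=\delta_{3,0}S_2^d+S_3^{d,1}+\delta_{3,1}S_2^d+\cdots+\delta_{3,2d-1}S_2^d+S_3^{d,2d}+\delta_{3,2d}S_2^d,$$ where $S_3^{d,1}=S_3^{d,2d}=\emptyset$ and, for $2\le p\le 2d-1$, $$S_3^{d,p}=\begin{cases} \sigma_1\bigl(S_3^{d-1,p-1}+\delta_{3,p-1}S_2^{d-1}+S_3^{d-1,p}\bigr)& p\equiv 0 \pmod 4,\\ \sigma_2\sigma_1\bigl(S_3^{d-1,p-2}+\delta_{3,p-2}S_2^{d-1}+S_3^{d-1,p-1}\bigr)& p\equiv 1 \pmod 4,\\ \sigma_2\bigl(S_3^{d-1,p-1}+\delta_{3,p-1}S_2^{d-1}+S_3^{d-1,p}\bigr)& p\equiv 2 \pmod 4,\\ \sigma_1\sigma_2\bigl(S_3^{d-1,p-2}+\delta_{3,p-2}S_2^{d-1}+S_3^{d-1,p-1}\bigr)&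 p\equiv 3 \pmod 4. \end{cases}$$ Then, for every $d\ge 0$, $S_3^d$ is the $<$-increasing enumeration of $\mathrm{Div}(\Delta_3^d)$: its entries are exactly the elements of $\mathrm{Div}(\Delta_3^d)$, each occurring once, and for any two positions $i,j$ the $i$-th entry is $<$ the $j$-th entry if and only if $i<j$. -/

import Mathlib

noncomputable section

namespace BraidOrder

/-! Generators are indexed from `0`: the letter `i : ℕ` stands for the Artin generator
`σ_{i+1}`. -/

/-- The braid relations: `σ_i σ_j = σ_j σ_i` for `|i - j| ≥ 2`, and
`σ_i σ_j σ_i = σ_j σ_i σ_j` for `|i - j| = 1`. -/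
inductive Rel : FreeMonoid ℕ → FreeMonoid ℕ → Prop
  | comm (i j : ℕ) (h : i + 2 ≤ j ∨ j + 2 ≤ i) :
      Rel (FreeMonoid.of i * FreeMonoid.of j) (FreeMonoid.of j * FreeMonoid.of i)
  | braid (i j : ℕ) (h : i + 1 = j ∨ j + 1 = i) :
      Rel (FreeMonoid.of i * FreeMonoid.of j * FreeMonoid.of i)
        (FreeMonoid.of j * FreeMonoid.of i * FreeMonoid.of j)

/-- The monoid `B_∞^+` of positive braids. -/
abbrev PosBraid : Type := PresentedMonoid Rel

/-- The braid relations as relators `u v⁻¹` in the free group. -/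
def relators : Set (FreeGroup ℕ) :=
  {r | ∃ u v : FreeMonoid ℕ, Rel u v ∧
    r = FreeMonoid.lift FreeGroup.of u * (FreeMonoid.lift FreeGroup.of v)⁻¹}

/-- The braid group `B_∞`. -/
abbrev Braid : Type := PresentedGroup relators

/-- The generator of the braid monoid with (zero-based) index `i`. -/
def σ (i : ℕ) : PosBraid := PresentedMonoid.of Rel i

theorem toBraid_rel (a b : FreeMonoid ℕ) (h : Rel a b) :
    FreeMonoid.lift (fun i : ℕ => (PresentedGroup.of i : Braid)) a =
      FreeMonoid.lift (fun i : ℕ => (PresentedGroup.of i : Braid)) b := by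
  have key : ∀ u : FreeMonoid ℕ,
      FreeMonoid.lift (fun i : ℕ => (PresentedGroup.of i : Braid)) u =
        PresentedGroup.mk relators (FreeMonoid.lift FreeGroup.of u) := by
    intro u
    have : FreeMonoid.lift (fun i : ℕ => (PresentedGroup.of i : Braid)) =
        (PresentedGroup.mk relators).comp (FreeMonoid.lift FreeGroup.of) :=
      FreeMonoid.hom_eq (fun i => by simp [PresentedGroup.of])
    rw [this]; rfl
  have h1 : PresentedGroup.mk relators
      (FreeMonoid.lift FreeGroup.of a * (FreeMonoid.lift FreeGroup.of b)⁻¹) = 1 :=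
    PresentedGroup.one_of_mem ⟨a, b, h, rfl⟩
  rw [key, key]
  rwa [map_mul, map_inv, mul_inv_eq_one] at h1

/-- The canonical homomorphism `B_∞^+ → B_∞`. -/
def toBraid : PosBraid →* Braid :=
  PresentedMonoid.lift (fun i : ℕ => (PresentedGroup.of i : Braid)) toBraid_rel

/-- The braid represented by a braid word; the letter `(i, true)` is the generator of index `i`
and `(i, false)` is its inverse. -/
def wordBraid (w : List (ℕ × Bool)) : Braid :=
  (w.map fun l => if l.2 then (PresentedGroup.of l.1 : Braid) else (PresentedGroup.of l.1)⁻¹).prod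

/-- A braid word is `σ`-positive if its generator of largest index occurs positively and does not
occur negatively. -/
def SigmaPositive (w : List (ℕ × Bool)) : Prop :=
  ∃ m : ℕ, (m, true) ∈ w ∧ (m, false) ∉ w ∧ ∀ l ∈ w, l.1 ≤ m

/-- The braid order: `x < y` if `x⁻¹ y` has a `σ`-positive expression. -/
def Lt (x y : Braid) : Prop :=
  ∃ w : List (ℕ × Bool), SigmaPositive w ∧ wordBraid w = x⁻¹ * y

/-- The braid order on positive braids. -/
def PosLt (x y : PosBraid) : Prop := Lt (toBraid x) (toBraid y)

/-- The set of left divisors of a positive braid. -/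
def Div (y : PosBraid) : Set PosBraid := {x | ∃ z : PosBraid, y = x * z}

/-- The fundamental braid: `Δ_1 = 1`, `Δ_{n+1} = σ_1 ⋯ σ_n Δ_n` (and `Δ_0 = 1`). -/
def Delta : ℕ → PosBraid
  | 0 => 1
  | n + 1 => ((List.range n).map σ).prod * Delta n

/-- For `n ≥ 2`, the letter in position `k` (`k = 0, 1, …`), counted from the right, of the left
infinite periodic word with period `σ_{n-1} ⋯ σ_2 σ_1 σ_1 σ_2 ⋯ σ_{n-1}`
(zero-based generator index). -/
def deltaLetter (n k : ℕ) : ℕ :=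
  let r := k % (2 * (n - 1))
  if r < n - 1 then n - 2 - r else r - (n - 1)

/-- The braid `δ_{n,p}` (for `n ≥ 2`), represented by the suffix of length `p` of the left infinite
word described in `deltaLetter`. -/
def delta (n : ℕ) : ℕ → PosBraid
  | 0 => 1
  | p + 1 => σ (deltaLetter n p) * delta n p

/-- The translated sequence `x S`. -/
def translate (x : PosBraid) (S : List PosBraid) : List PosBraid := S.map fun y => x * y

/-- The sequence `S_1^d = (1)`. -/
def S₁ (_d : ℕ) : List PosBraid := [1]

/-- The sequence `S_2^d = δ_{2,0} S_1^d + δ_{2,1} S_1^d + ⋯ + δ_{2,d} S_1^d`. -/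
def S₂ (d : ℕ) : List PosBraid :=
  (List.range (d + 1)).flatMap fun i => translate (delta 2 i) (S₁ d)

/-- The sequence `S_3^{d,p}`; it is empty unless `2 ≤ p ≤ 2 d - 1`. Here `σ 0` is `σ_1` and
`σ 1` is `σ_2`. -/
def S₃part : ℕ → ℕ → List PosBraid
  | 0, _ => []
  | d + 1, p =>
    if 2 ≤ p ∧ p ≤ 2 * d + 1 then
      if p % 4 = 0 then
        translate (σ 0) (S₃part d (p - 1) ++ translate (delta 3 (p - 1)) (S₂ d) ++ S₃part d p)
      else if p % 4 = 1 then
        translate (σ 1 * σ 0)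
          (S₃part d (p - 2) ++ translate (delta 3 (p - 2)) (S₂ d) ++ S₃part d (p - 1))
      else if p % 4 = 2 then
        translate (σ 1) (S₃part d (p - 1) ++ translate (delta 3 (p - 1)) (S₂ d) ++ S₃part d p)
      else
        translate (σ 0 * σ 1)
          (S₃part d (p - 2) ++ translate (delta 3 (p - 2)) (S₂ d) ++ S₃part d (p - 1))
    else []

/-- The sequence
`S_3^d = δ_{3,0} S_2^d + S_3^{d,1} + δ_{3,1} S_2^d + ⋯ + S_3^{d,2d} + δ_{3,2d} S_2^d`. -/
def S₃ (d : ℕ) : List PosBraid :=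
  translate (delta 3 0) (S₂ d) ++
    (List.range (2 * d)).flatMap fun q =>
      S₃part d (q + 1) ++ translate (delta 3 (q + 1)) (S₂ d)

/-- `S` is the increasing enumeration of the set `D` with respect to the relation `r`: its entries
are exactly the elements of `D`, and its entries compare under `r` exactly as their positions do.
In particular (as `i < i` fails) `r` is irreflexive on `D`, no element is repeated in `S`, and `r`
restricts to a strict linear order on `D`. -/
def IsIncreasingEnumeration {α : Type*} (r : α → α → Prop) (S : List α) (D : Set α) : Prop :=
  (∀ x, x ∈ S ↔ x ∈ D) ∧ ∀ i j : Fin S.length, r (S.get i) (S.get j) ↔ i < j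

end BraidOrder

end

namespace BraidOrder

/-! ### Leading letters in free groups -/

/-! Write Δ for Δ₃ and `simples` for its six divisors. The theorem splits into a statement about
sets and a statement about order.

Sets: both `Div (Delta 3 ^ d)` and the set of entries of `S₃ d` equal `simples ^ d`. For divisors, a
positive 3-braid has a normal form Δ^k times a word without alternating triples. The number of
simple factors that this form displays never drops under right multiplication and equals d for Δ^d,
so a divisor of Δ^d is a product of d simple braids (`Div_Delta_pow`). For entries, the identities
alt k · δ_{2k} = δ_{2k} σ_1 and Δ δ_{2k} = δ_{2k+2} σ_1 show that a simple braid times an entry of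
`S₃ d` is an entry of `S₃ (d + 1)` (`simples_mul_S₃`), and that each entry factors into d simple
braids (`InBlock.mem_simples_pow`).

Order: multiplying on the right by powers of σ_1 cannot affect a comparison witnessed by a word
containing σ_2 and no σ_2⁻¹ (`SigmaOneLt`). After such multiplications δ_{p+1} differs from δ_p by a
right factor σ_2, so the δ_p increase. Left multiplication preserves the order, and by induction on
d the part of rank p + 1 lies strictly between δ_p and δ_{p+1} (`sigmaOneLt_of_mem_S₃part`). Hence
`S₃ d` is increasing (`pairwise_S₃`).

The converse direction and the absence of repetitions need irreflexivity (`Lt.irrefl`). It comes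
from the Artin action on a free group: a σ-positive word with top index m sends x_{m+1}⁻¹ to a
reduced word that begins with x_{m+1}, so it cannot act trivially. -/

/-- The first letter of the reduced word of an element of a free group. -/
def lead (g : FreeGroup ℕ) : Option (ℕ × Bool) := g.toWord.head?

theorem toWord_mk_singleton_mul (c : ℕ × Bool) (g : FreeGroup ℕ)
    (h : lead g ≠ some (c.1, !c.2)) :
    (FreeGroup.mk [c] * g).toWord = c :: g.toWord := by
  have hg : FreeGroup.mk [c] * g = FreeGroup.mk (c :: g.toWord) := by
    conv_lhs => rw [← FreeGroup.mk_toWord (x := g)]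
    rw [FreeGroup.mul_mk]; rfl
  rw [hg, FreeGroup.toWord_mk, FreeGroup.IsReduced.reduce_eq]
  have hr := FreeGroup.isReduced_toWord (x := g)
  unfold lead at h
  cases hw : g.toWord with
  | nil => exact FreeGroup.IsReduced.singleton
  | cons b L =>
    rw [hw] at hr h
    refine FreeGroup.isReduced_cons_cons.2 ⟨fun h1 => ?_, hr⟩
    by_contra h2
    apply h
    obtain ⟨b1, b2⟩ := b
    obtain ⟨c1, c2⟩ := c
    simp only at h1 h2
    subst h1
    cases b2 <;> cases c2 <;> simp_all

theorem lead_mk_singleton_mul {c : ℕ × Bool} {g : FreeGroup ℕ}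
    (h : lead g ≠ some (c.1, !c.2)) : lead (FreeGroup.mk [c] * g) = some c := by
  rw [lead, toWord_mk_singleton_mul c g h]; rfl

theorem lead_one : lead 1 = none := by simp [lead]

theorem lead_eq_none {g : FreeGroup ℕ} (h : lead g = none) : g = 1 := by
  rw [lead, List.head?_eq_none_iff] at h
  exact FreeGroup.toWord_eq_nil_iff.1 h

-- Induction along reduced words: each step prepends a letter that does not cancel, so leading
-- letters can be tracked.
@[elab_as_elim]
theorem freeGroup_reduced_induction {C : FreeGroup ℕ → Prop} (h1 : C 1)
    (hc : ∀ (c : ℕ × Bool) (g : FreeGroup ℕ), lead g ≠ some (c.1, !c.2) → C g →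
      C (FreeGroup.mk [c] * g)) (g : FreeGroup ℕ) : C g := by
  suffices ∀ L : List (ℕ × Bool), FreeGroup.IsReduced L → C (FreeGroup.mk L) by
    have := this g.toWord FreeGroup.isReduced_toWord
    rwa [FreeGroup.mk_toWord] at this
  intro L
  induction L with
  | nil => intro _; exact h1
  | cons c L ih =>
    intro hL
    have hL' : FreeGroup.IsReduced L := hL.infix ⟨[c], [], by simp⟩
    have key : FreeGroup.mk (c :: L) = FreeGroup.mk [c] * FreeGroup.mk L := by
      rw [FreeGroup.mul_mk]; rfl
    rw [key]
    refine hc c _ ?_ (ih hL')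
    rw [lead, FreeGroup.toWord_mk, hL'.reduce_eq]
    cases L with
    | nil => simp
    | cons b L =>
      intro hb
      simp only [List.head?_cons, Option.some.injEq] at hb
      subst hb
      have := (FreeGroup.isReduced_cons_cons.1 hL).1 rfl
      simp at this

/-! ### The Artin action of the braid group on the free group -/

/-- The Artin endomorphism attached to a generator of the braid group. -/
def artinHom (i : ℕ) : FreeGroup ℕ →* FreeGroup ℕ :=
  FreeGroup.lift fun j =>
    if j = i then FreeGroup.of (i + 1)
    else if j = i + 1 then FreeGroup.of (i + 1) * FreeGroup.of i * (FreeGroup.of (i + 1))⁻¹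
    else FreeGroup.of j

/-- The inverse of `artinHom`. -/
def artinInv (i : ℕ) : FreeGroup ℕ →* FreeGroup ℕ :=
  FreeGroup.lift fun j =>
    if j = i then (FreeGroup.of i)⁻¹ * FreeGroup.of (i + 1) * FreeGroup.of i
    else if j = i + 1 then FreeGroup.of i
    else FreeGroup.of j

theorem artinHom_of_self (i : ℕ) : artinHom i (FreeGroup.of i) = FreeGroup.of (i + 1) := by
  simp [artinHom]

theorem artinHom_of_succ (i : ℕ) : artinHom i (FreeGroup.of (i + 1)) =
    FreeGroup.of (i + 1) * FreeGroup.of i * (FreeGroup.of (i + 1))⁻¹ := by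
  simp [artinHom]

theorem artinHom_of_ne {i j : ℕ} (h : j ≠ i) (h' : j ≠ i + 1) :
    artinHom i (FreeGroup.of j) = FreeGroup.of j := by
  simp [artinHom, h, h']

theorem artinInv_of_self (i : ℕ) : artinInv i (FreeGroup.of i) =
    (FreeGroup.of i)⁻¹ * FreeGroup.of (i + 1) * FreeGroup.of i := by
  simp [artinInv]

theorem artinInv_of_succ (i : ℕ) : artinInv i (FreeGroup.of (i + 1)) = FreeGroup.of i := by
  simp [artinInv]

theorem artinInv_of_ne {i j : ℕ} (h : j ≠ i) (h' : j ≠ i + 1) :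
    artinInv i (FreeGroup.of j) = FreeGroup.of j := by
  simp [artinInv, h, h']

/-- The Artin automorphism attached to a generator of the braid group. -/
def artin (i : ℕ) : MulAut (FreeGroup ℕ) :=
  MonoidHom.toMulEquiv (artinHom i) (artinInv i)
    (by
      ext j
      by_cases h : j = i
      · subst h; simp [artinHom_of_self, artinInv_of_succ]
      by_cases h' : j = i + 1
      · subst h'
        simp [artinHom_of_succ, artinInv_of_self, artinInv_of_succ, mul_assoc]
      · simp [artinHom_of_ne h h', artinInv_of_ne h h'])
    (by
      ext j
      by_cases h : j = i
      · subst h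
        simp [artinInv_of_self, artinHom_of_self, artinHom_of_succ, mul_assoc]
      by_cases h' : j = i + 1
      · subst h'
        simp [artinInv_of_succ, artinHom_of_self]
      · simp [artinHom_of_ne h h', artinInv_of_ne h h'])

theorem artin_apply (i : ℕ) (g : FreeGroup ℕ) : artin i g = artinHom i g := rfl

theorem artinHom_comm {i j : ℕ} (h : i + 2 ≤ j) :
    (artinHom i).comp (artinHom j) = (artinHom j).comp (artinHom i) := by
  ext k
  simp only [MonoidHom.comp_apply]
  by_cases h1 : k = i
  · subst h1
    rw [artinHom_of_ne (i := j) (by omega) (by omega), artinHom_of_self,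
      artinHom_of_ne (i := j) (by omega) (by omega)]
  by_cases h2 : k = i + 1
  · subst h2
    rw [artinHom_of_ne (i := j) (by omega) (by omega), artinHom_of_succ]
    simp only [map_mul, map_inv]
    rw [artinHom_of_ne (i := j) (by omega) (by omega),
      artinHom_of_ne (i := j) (by omega) (by omega)]
  by_cases h3 : k = j
  · subst h3
    rw [artinHom_of_ne h1 h2, artinHom_of_self, artinHom_of_ne (by omega) (by omega)]
  by_cases h4 : k = j + 1
  · subst h4
    rw [artinHom_of_ne h1 h2, artinHom_of_succ]
    simp only [map_mul, map_inv]
    rw [artinHom_of_ne h1 h2, artinHom_of_ne (i := i) (by omega) (by omega)]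
  rw [artinHom_of_ne h1 h2, artinHom_of_ne h3 h4, artinHom_of_ne h1 h2]

theorem artinHom_braid (i : ℕ) :
    ((artinHom i).comp (artinHom (i + 1))).comp (artinHom i) =
      ((artinHom (i + 1)).comp (artinHom i)).comp (artinHom (i + 1)) := by
  have e1 := artinHom_of_self i
  have e2 := artinHom_of_succ i
  have e3 := artinHom_of_self (i + 1)
  have e4 := artinHom_of_succ (i + 1)
  have e5 : artinHom (i + 1) (FreeGroup.of i) = FreeGroup.of i :=
    artinHom_of_ne (by omega) (by omega)
  have e6 : artinHom i (FreeGroup.of (i + 1 + 1)) = FreeGroup.of (i + 1 + 1) :=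
    artinHom_of_ne (by omega) (by omega)
  ext k
  simp only [MonoidHom.comp_apply]
  by_cases h1 : k = i
  · subst h1; simp only [e1, e3, e5, e6]
  by_cases h2 : k = i + 1
  · subst h2; simp only [e1, e2, e3, e4, e5, e6, map_mul, map_inv]
  by_cases h3 : k = i + 1 + 1
  · subst h3; simp only [e2, e3, e4, e5, e6, map_mul, map_inv]; group
  rw [artinHom_of_ne h1 h2, artinHom_of_ne h2 h3, artinHom_of_ne h1 h2, artinHom_of_ne h2 h3]

theorem artin_rel {u v : FreeMonoid ℕ} (h : Rel u v) :
    FreeMonoid.lift artin u = FreeMonoid.lift artin v := by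
  have comm : ∀ i j : ℕ, i + 2 ≤ j → artin i * artin j = artin j * artin i := fun i j hij =>
    MulEquiv.ext fun g => DFunLike.congr_fun (artinHom_comm hij) g
  have braid : ∀ i : ℕ, artin i * artin (i + 1) * artin i =
      artin (i + 1) * artin i * artin (i + 1) := fun i =>
    MulEquiv.ext fun g => DFunLike.congr_fun (artinHom_braid i) g
  cases h with
  | comm i j h =>
    simp only [map_mul, FreeMonoid.lift_eval_of]
    rcases h with h | h
    · exact comm i j h
    · exact (comm j i h).symm
  | braid i j h =>
    simp only [map_mul, FreeMonoid.lift_eval_of]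
    rcases h with h | h
    · subst h; exact braid i
    · subst h; exact (braid j).symm

theorem artin_relators : ∀ r ∈ relators, FreeGroup.lift artin r = 1 := by
  rintro r ⟨u, v, h, rfl⟩
  have key : ∀ w : FreeMonoid ℕ, FreeGroup.lift artin (FreeMonoid.lift FreeGroup.of w) =
      FreeMonoid.lift artin w := fun w =>
    DFunLike.congr_fun (f := (FreeGroup.lift artin).comp (FreeMonoid.lift FreeGroup.of))
      (FreeMonoid.hom_eq fun i => by simp) w
  rw [map_mul, map_inv, key, key, artin_rel h, mul_inv_cancel]

/-- The Artin representation of the braid group. -/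
def artinRep : Braid →* MulAut (FreeGroup ℕ) := PresentedGroup.toGroup artin_relators

theorem artinRep_of (i : ℕ) : artinRep (PresentedGroup.of i) = artin i :=
  PresentedGroup.toGroup.of artin_relators

/-! ### Irreflexivity of the braid order -/

theorem mk_singleton_eq (c : ℕ × Bool) : FreeGroup.mk [c] =
    if c.2 then FreeGroup.of c.1 else (FreeGroup.of c.1)⁻¹ := by
  obtain ⟨j, e⟩ := c
  cases e <;> simp [FreeGroup.of, FreeGroup.inv_mk, FreeGroup.invRev]

/-- With x_j for `FreeGroup.of j`, the map sends x_i to x_{i+1} and x_{i+1} to x_{i+1} x_i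
x_{i+1}⁻¹. The leading letter alone is not inductive: a trailing x_{i+1}⁻¹ may cancel with the start
of what follows. The clauses with the prefix x_{i+1}⁻¹ therefore also record what comes after an
initial x_{i+1}. -/
theorem artinHom_lead (i : ℕ) (g : FreeGroup ℕ) : ∀ c, lead g = some c →
    (c.1 ≠ i → c.1 ≠ i + 1 → lead (artinHom i g) = some c) ∧
    (c.1 = i + 1 → lead (FreeGroup.mk [(i + 1, false)] * artinHom i g) = some (i, c.2)) ∧
    (c = (i, true) → lead (artinHom i g) = some (i + 1, true) ∧
      ∀ e, lead (FreeGroup.mk [(i + 1, false)] * artinHom i g) ≠ some (i, e)) ∧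
    (c = (i, false) → lead (artinHom i g) = some (i + 1, false) ∨
      ∃ e, lead (artinHom i g) = some (i, e)) := by
  induction g using freeGroup_reduced_induction with
  | h1 => intro c hc; simp [lead_one] at hc
  | hc b g hb ih =>
    have cancel : ∀ e : Bool, ∀ j : ℕ, ∀ x : FreeGroup ℕ,
        FreeGroup.mk [(j, e)] * (FreeGroup.mk [(j, !e)] * x) = x := by
      intro e j x
      rw [mk_singleton_eq, mk_singleton_eq]
      cases e <;> simp
    have hsucc : ∀ e, lead g = some (i + 1, e) → lead (artinHom i g) = some (i + 1, true) := by
      intro e he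
      have := (ih _ he).2.1 rfl
      rw [← cancel true (i + 1) (artinHom i g)]
      apply lead_mk_singleton_mul
      rw [Bool.not_true, this]
      simp
    have hY : lead (artinHom i g) ≠ some (i + 1, true) →
        lead (FreeGroup.mk [(i + 1, false)] * artinHom i g) = some (i + 1, false) :=
      fun h => lead_mk_singleton_mul h
    rw [lead_mk_singleton_mul hb]
    intro c hc
    obtain rfl := Option.some.inj hc
    refine ⟨fun h1 h2 => ?_, fun h => ?_, fun h => ?_, fun h => ?_⟩
    · have hbs : artinHom i (FreeGroup.mk [b]) = FreeGroup.mk [b] := by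
        rw [mk_singleton_eq]
        split_ifs <;> simp [artinHom_of_ne h1 h2]
      rw [map_mul, hbs]
      apply lead_mk_singleton_mul
      rcases hg : lead g with _ | ⟨k, e⟩
      · rw [lead_eq_none hg, map_one, lead_one]; simp
      by_cases hk : k = i
      · subst hk
        cases e with
        | true => rw [((ih _ hg).2.2.1 rfl).1]; simp [Ne.symm h2]
        | false =>
          rcases (ih _ hg).2.2.2 rfl with h | ⟨e, h⟩ <;> rw [h] <;> simp [Ne.symm h2, Ne.symm h1]
      by_cases hk' : k = i + 1
      · subst hk'; rw [hsucc e hg]; simp [Ne.symm h2]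
      · rw [(ih _ hg).1 hk hk', ← hg]; exact hb
    · obtain ⟨j, e⟩ := b
      simp only at h
      subst h
      have hbs : artinHom i (FreeGroup.mk [(i + 1, e)]) =
          FreeGroup.mk [(i + 1, true)] *
            (FreeGroup.mk [(i, e)] * FreeGroup.mk [(i + 1, false)]) := by
        simp only [mk_singleton_eq]
        cases e <;> simp [artinHom_of_succ, mul_assoc]
      rw [map_mul, hbs, mul_assoc, mul_assoc]
      refine (congrArg lead (cancel false (i + 1) _)).trans (lead_mk_singleton_mul ?_)
      rcases hg : lead g with _ | ⟨k, e'⟩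
      · rw [hY (by rw [lead_eq_none hg, map_one, lead_one]; simp)]; simp
      by_cases hk : k = i
      · subst hk
        cases e' with
        | true => exact ((ih _ hg).2.2.1 rfl).2 _
        | false =>
          rw [hY (by rcases (ih _ hg).2.2.2 rfl with h | ⟨e, h⟩ <;> rw [h] <;> simp)]; simp
      by_cases hk' : k = i + 1
      · subst hk'
        rw [(ih _ hg).2.1 rfl]
        intro h
        simp only [Option.some.injEq, Prod.mk.injEq, true_and] at h
        -- A cancellation of x_i^{±1} would force two adjacent inverse letters x_{i+1}^{±1} in the
        -- reduced word.
        exact hb (by rw [hg, h])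
      · rw [hY (by rw [(ih _ hg).1 hk hk']; simp [hk'])]; simp
    · subst h
      have hbs : artinHom i (FreeGroup.mk [(i, true)]) = FreeGroup.mk [(i + 1, true)] := by
        simp only [mk_singleton_eq]
        simp [artinHom_of_self]
      have h1 : lead (artinHom i g) ≠ some (i + 1, false) ∧
          ∀ e, lead (artinHom i g) ≠ some (i, e) := by
        rcases hg : lead g with _ | ⟨k, e'⟩
        · rw [lead_eq_none hg, map_one, lead_one]; simp
        by_cases hk : k = i
        · subst hk
          cases e' with
          | true => rw [((ih _ hg).2.2.1 rfl).1]; simp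
          | false => exact absurd hg hb
        by_cases hk' : k = i + 1
        · subst hk'; rw [hsucc _ hg]; simp
        · rw [(ih _ hg).1 hk hk']; simp [hk, hk']
      rw [map_mul, hbs]
      refine ⟨lead_mk_singleton_mul h1.1, fun e => ?_⟩
      exact ne_of_eq_of_ne (congrArg lead (cancel false (i + 1) _)) (h1.2 e)
    · subst h
      have hbs : artinHom i (FreeGroup.mk [(i, false)]) = FreeGroup.mk [(i + 1, false)] := by
        simp only [mk_singleton_eq]
        simp [artinHom_of_self]
      rw [map_mul, hbs]
      rcases hg : lead g with _ | ⟨k, e'⟩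
      · exact Or.inl (hY (by rw [lead_eq_none hg, map_one, lead_one]; simp))
      by_cases hk : k = i
      · subst hk
        cases e' with
        | true => exact absurd hg hb
        | false =>
          exact Or.inl (hY (by rcases (ih _ hg).2.2.2 rfl with h | ⟨e, h⟩ <;> rw [h] <;> simp))
      by_cases hk' : k = i + 1
      -- The only case with cancellation: x_{i+1}⁻¹ removes the initial x_{i+1} and exposes
      -- x_i^{±1}.
      · subst hk'; exact Or.inr ⟨_, (ih _ hg).2.1 rfl⟩
      · exact Or.inl (hY (by rw [(ih _ hg).1 hk hk']; simp [hk']))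

theorem artinHom_lead_succ {i : ℕ} {g : FreeGroup ℕ} {e : Bool} (h : lead g = some (i + 1, e)) :
    lead (artinHom i g) = some (i + 1, true) := by
  have h1 := (artinHom_lead i g _ h).2.1 rfl
  have h2 : artinHom i g =
      FreeGroup.mk [(i + 1, true)] * (FreeGroup.mk [(i + 1, false)] * artinHom i g) := by
    simp [mk_singleton_eq]
  rw [h2]
  apply lead_mk_singleton_mul
  rw [h1]
  simp

/-- This reflects leading letters through a generator, so inverse generators of small index need no
analysis of their own. -/
theorem lead_of_lead_artinHom {i n : ℕ} {e : Bool} {g : FreeGroup ℕ} (hn : n ≠ i)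
    (hn' : n ≠ i + 1) (h : lead (artinHom i g) = some (n, e)) : lead g = some (n, e) := by
  rcases hg : lead g with _ | ⟨k, f⟩
  · rw [lead_eq_none hg, map_one, lead_one] at h; simp at h
  have hl := artinHom_lead i g _ hg
  by_cases hk : k = i
  · subst hk
    cases f with
    | true => rw [(hl.2.2.1 rfl).1] at h; simp [Ne.symm hn'] at h
    | false =>
      rcases hl.2.2.2 rfl with h' | ⟨e, h'⟩ <;> rw [h'] at h <;> simp [Ne.symm hn, Ne.symm hn'] at h
  by_cases hk' : k = i + 1
  · subst hk'; rw [artinHom_lead_succ hg] at h; simp [Ne.symm hn'] at h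
  · rw [← h, hl.1 hk hk']

theorem artin_symm_of_ne {i j : ℕ} (h : j ≠ i) (h' : j ≠ i + 1) :
    (artin i)⁻¹ (FreeGroup.of j) = FreeGroup.of j :=
  artinInv_of_ne h h'

theorem wordBraid_cons (l : ℕ × Bool) (w : List (ℕ × Bool)) : wordBraid (l :: w) =
    (if l.2 then (PresentedGroup.of l.1 : Braid) else (PresentedGroup.of l.1)⁻¹) *
      wordBraid w := by
  simp [wordBraid]

theorem artinRep_wordBraid_lead {m : ℕ} {w : List (ℕ × Bool)} (hm : (m, false) ∉ w)
    (hw : ∀ l ∈ w, l.1 ≤ m) {g : FreeGroup ℕ} (hg : lead g = some (m + 1, true)) :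
    lead (artinRep (wordBraid w) g) = some (m + 1, true) := by
  induction w with
  | nil => simpa [wordBraid] using hg
  | cons l w ih =>
    have h1 := ih (fun h => hm (List.mem_cons_of_mem _ h))
      (fun x hx => hw x (List.mem_cons_of_mem _ hx))
    have h2 := hw l List.mem_cons_self
    have h3 : l ≠ (m, false) := fun h => hm (h ▸ List.mem_cons_self)
    obtain ⟨i, e⟩ := l
    rw [wordBraid_cons, map_mul, MulAut.mul_apply]
    simp only at h2
    cases e with
    | true =>
      simp only [if_true, artinRep_of, artin_apply]
      rcases h2.eq_or_lt with rfl | h2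
      · exact artinHom_lead_succ h1
      · exact (artinHom_lead i _ _ h1).1 (by simp only; omega) (by simp only; omega)
    | false =>
      simp only [Bool.false_eq_true, if_false, map_inv, artinRep_of]
      have h2 : i < m := lt_of_le_of_ne h2 (fun h => h3 (by rw [h]))
      apply lead_of_lead_artinHom (i := i) (by omega) (by omega)
      rwa [← artin_apply, ← MulAut.mul_apply, mul_inv_cancel, MulAut.one_apply]

theorem artinRep_wordBraid_of {m : ℕ} {w : List (ℕ × Bool)} (hw : ∀ l ∈ w, l.1 < m) :
    artinRep (wordBraid w) (FreeGroup.of (m + 1)) = FreeGroup.of (m + 1) := by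
  induction w with
  | nil => simp [wordBraid]
  | cons l w ih =>
    have h2 := hw l List.mem_cons_self
    obtain ⟨i, e⟩ := l
    simp only at h2
    rw [wordBraid_cons, map_mul, MulAut.mul_apply, ih fun x hx => hw x (List.mem_cons_of_mem _ hx)]
    cases e with
    | true =>
      simp only [if_true, artinRep_of, artin_apply]
      exact artinHom_of_ne (by omega) (by omega)
    | false =>
      simp only [Bool.false_eq_true, if_false, map_inv, artinRep_of]
      exact artin_symm_of_ne (by omega) (by omega)

/-- Letters act from right to left. Those to the right of the last letter m have smaller index and
fix x_{m+1}. That letter turns x_{m+1}⁻¹ into x_{m+1} x_m⁻¹ x_{m+1}⁻¹, and all letters further left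
keep the leading x_{m+1}. -/
theorem artinRep_wordBraid_inv_lead {m : ℕ} {w : List (ℕ × Bool)} (hm : (m, false) ∉ w)
    (hm' : (m, true) ∈ w) (hw : ∀ l ∈ w, l.1 ≤ m) :
    lead (artinRep (wordBraid w) (FreeGroup.of (m + 1))⁻¹) = some (m + 1, true) := by
  induction w with
  | nil => simp at hm'
  | cons l w ih =>
    have hmw : (m, false) ∉ w := fun h => hm (List.mem_cons_of_mem _ h)
    have hww : ∀ x ∈ w, x.1 ≤ m := fun x hx => hw x (List.mem_cons_of_mem _ hx)
    by_cases h : (m, true) ∈ w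
    · have := artinRep_wordBraid_lead (w := [l])
        (fun h => hm (by rw [List.mem_singleton.1 h]; exact List.mem_cons_self))
        (fun x hx => hw x (by rw [List.mem_singleton.1 hx]; exact List.mem_cons_self))
        (ih hmw h hww)
      rwa [← MulAut.mul_apply, ← map_mul,
        show wordBraid [l] * wordBraid w = wordBraid (l :: w) by simp [wordBraid]] at this
    · have hl : (m, true) = l := (List.mem_cons.1 hm').resolve_right h
      subst hl
      have hlt : ∀ x ∈ w, x.1 < m := by
        rintro ⟨i, e⟩ hx
        refine lt_of_le_of_ne (hww _ hx) ?_
        rintro rfl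
        cases e
        · exact hmw hx
        · exact h hx
      rw [wordBraid_cons, map_mul, MulAut.mul_apply, map_inv, artinRep_wordBraid_of hlt]
      simp only [if_true, artinRep_of, artin_apply, map_inv, artinHom_of_succ]
      have : (FreeGroup.of (m + 1) * FreeGroup.of m * (FreeGroup.of (m + 1))⁻¹)⁻¹ =
          FreeGroup.mk [(m + 1, true)] * (FreeGroup.mk [(m, false)] *
            (FreeGroup.mk [(m + 1, false)] * 1)) := by
        simp [mk_singleton_eq, mul_assoc]
      rw [this]
      have h1 : lead (FreeGroup.mk [(m + 1, false)] * 1) = some (m + 1, false) :=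
        lead_mk_singleton_mul (by simp [lead_one])
      have h2 : lead (FreeGroup.mk [(m, false)] * (FreeGroup.mk [(m + 1, false)] * 1)) =
          some (m, false) := lead_mk_singleton_mul (by rw [h1]; simp)
      exact lead_mk_singleton_mul (by rw [h2]; simp)

/-- A `σ`-positive word does not represent the trivial braid. -/
theorem SigmaPositive.wordBraid_ne_one {w : List (ℕ × Bool)} (h : SigmaPositive w) :
    wordBraid w ≠ 1 := by
  obtain ⟨m, h1, h2, h3⟩ := h
  intro hw
  have := artinRep_wordBraid_inv_lead h2 h1 h3
  rw [hw, map_one, MulAut.one_apply] at this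
  have h4 : lead (FreeGroup.of (m + 1))⁻¹ = some (m + 1, false) := by
    have : (FreeGroup.of (m + 1))⁻¹ = FreeGroup.mk [(m + 1, false)] * 1 := by
      simp [mk_singleton_eq]
    rw [this]
    exact lead_mk_singleton_mul (by simp [lead_one])
  rw [h4] at this
  simp at this

theorem wordBraid_append (v w : List (ℕ × Bool)) :
    wordBraid (v ++ w) = wordBraid v * wordBraid w := by
  simp [wordBraid]

theorem Lt.irrefl (x : Braid) : ¬ Lt x x := by
  rintro ⟨w, hw, h⟩
  exact hw.wordBraid_ne_one (by rw [h, inv_mul_cancel])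

theorem SigmaPositive.append {v w : List (ℕ × Bool)} (hv : SigmaPositive v)
    (hw : SigmaPositive w) : SigmaPositive (v ++ w) := by
  obtain ⟨m, h1, h2, h3⟩ := hv
  obtain ⟨n, k1, k2, k3⟩ := hw
  have key : ∀ {m n : ℕ} {v : List (ℕ × Bool)}, (∀ l ∈ v, l.1 ≤ m) → m < n → (n, false) ∉ v :=
    fun h hmn hv => absurd (h _ hv) (by simp only; omega)
  rcases lt_trichotomy m n with h | rfl | h
  · refine ⟨n, by simp [k1], by simp [k2, key h3 h], fun l hl => ?_⟩
    rcases List.mem_append.1 hl with hl | hl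
    · exact (h3 l hl).trans h.le
    · exact k3 l hl
  · refine ⟨m, by simp [k1], by simp [k2, h2], fun l hl => ?_⟩
    rcases List.mem_append.1 hl with hl | hl
    · exact h3 l hl
    · exact k3 l hl
  · refine ⟨m, by simp [h1], by simp [h2, key k3 h], fun l hl => ?_⟩
    rcases List.mem_append.1 hl with hl | hl
    · exact h3 l hl
    · exact (k3 l hl).trans h.le

theorem Lt.trans {x y z : Braid} (hxy : Lt x y) (hyz : Lt y z) : Lt x z := by
  obtain ⟨v, hv, h⟩ := hxy
  obtain ⟨w, hw, k⟩ := hyz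
  exact ⟨v ++ w, hv.append hw, by rw [wordBraid_append, h, k]; group⟩

/-! ### Normal forms of positive 3-braids

The pair `(k, l)` stands for `Δ₃ ^ k` times the word whose letters, read from right to left, are
those of `l`, where `false` is `σ 0` and `true` is `σ 1`. -/

/-- No three consecutive letters alternate. -/
def NoAlternatingTriple : List Bool → Prop
  | x :: y :: z :: l => (x = y ∨ y = z) ∧ NoAlternatingTriple (y :: z :: l)
  | _ => True

theorem NoAlternatingTriple.tail {x : Bool} {l : List Bool} (h : NoAlternatingTriple (x :: l)) :
    NoAlternatingTriple l := by
  match l, h with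
  | [], _ => trivial
  | [_], _ => trivial
  | _ :: _ :: _, h => exact h.2

theorem NoAlternatingTriple.map_not {l : List Bool} (h : NoAlternatingTriple l) :
    NoAlternatingTriple (l.map not) := by
  induction l with
  | nil => trivial
  | cons x l ih =>
    match l, h, ih with
    | [], _, _ => trivial
    | [_], _, _ => trivial
    | y :: z :: l, h, ih =>
      refine ⟨?_, ih h.2⟩
      rcases h.1 with h | h <;> simp [h]

/-- Right multiplication of a normal form by a generator. -/
def nfStep (c : Bool) (s : ℕ × List Bool) : ℕ × List Bool :=
  match s.2 with
  | y :: x :: l => if y ≠ c ∧ x = c then (s.1 + 1, l.map not) else (s.1, c :: y :: x :: l)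
  | l => (s.1, c :: l)

theorem NoAlternatingTriple.nfStep {s : ℕ × List Bool} (h : NoAlternatingTriple s.2) (c : Bool) :
    NoAlternatingTriple (nfStep c s).2 := by
  obtain ⟨k, l⟩ := s
  match l, h with
  | [], _ => trivial
  | [_], _ => trivial
  | y :: x :: l, h =>
    simp only [BraidOrder.nfStep]
    split_ifs with h1
    · exact h.tail.tail.map_not
    · refine ⟨?_, h⟩
      cases c <;> cases y <;> cases x <;> simp_all

/-- This makes the normal form depend on the braid and not on the word. Splitting on the top four
letters settles it. -/
theorem nfStep_braid {s : ℕ × List Bool} (h : NoAlternatingTriple s.2) :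
    nfStep false (nfStep true (nfStep false s)) = nfStep true (nfStep false (nfStep true s)) := by
  obtain ⟨k, l⟩ := s
  match l, h with
  | [], _ => rfl
  | [x], _ => cases x <;> rfl
  | [x, y], _ => cases x <;> cases y <;> rfl
  | [x, y, z], h =>
    cases x <;> cases y <;> cases z <;> simp [NoAlternatingTriple, nfStep] at h ⊢
  | x :: y :: z :: w :: l, h =>
    cases x <;> cases y <;> cases z <;> cases w <;>
      simp [NoAlternatingTriple, nfStep] at h ⊢

/-- The normal forms of positive 3-braids. -/
abbrev NF : Type := {s : ℕ × List Bool // NoAlternatingTriple s.2}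

/-- Right multiplication by the generator of index `i`; the result is `none` outside of the
monoid of positive 3-braids. -/
def nfGen (i : ℕ) : Function.End (Option NF) := fun s =>
  if i = 0 then s.map fun s => ⟨nfStep false s.1, s.2.nfStep false⟩
  else if i = 1 then s.map fun s => ⟨nfStep true s.1, s.2.nfStep true⟩
  else none

theorem nfGen_zero (s : NF) : nfGen 0 (some s) = some ⟨nfStep false s.1, s.2.nfStep false⟩ := rfl

theorem nfGen_one (s : NF) : nfGen 1 (some s) = some ⟨nfStep true s.1, s.2.nfStep true⟩ := rfl

theorem nfGen_none (i : ℕ) : nfGen i none = none := by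
  simp [nfGen]

theorem nfGen_of_two_le {i : ℕ} (h : 2 ≤ i) (s : Option NF) : nfGen i s = none := by
  simp [nfGen, show i ≠ 0 by omega, show i ≠ 1 by omega]

/-- A relation involving an index of at least 2 has both sides constantly `none`, which leaves only
the braid relation between 0 and 1. The opposite monoid appears because the action is by right
multiplication. -/
theorem nfGen_rel (u v : FreeMonoid ℕ) (h : Rel u v) :
    FreeMonoid.lift (fun i => MulOpposite.op (nfGen i)) u =
      FreeMonoid.lift (fun i => MulOpposite.op (nfGen i)) v := by
  have braid : ∀ i : ℕ, nfGen i * (nfGen (i + 1) * nfGen i) =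
      nfGen (i + 1) * (nfGen i * nfGen (i + 1)) := by
    intro i
    funext s
    change nfGen i (nfGen (i + 1) (nfGen i s)) = nfGen (i + 1) (nfGen i (nfGen (i + 1) s))
    rcases s with _ | s
    · simp [nfGen_none]
    rcases i with _ | i
    · simp only [zero_add, nfGen_zero, nfGen_one, nfStep_braid s.2]
    · rw [nfGen_of_two_le (i := i + 1 + 1) (by omega), nfGen_of_two_le (i := i + 1 + 1) (by omega),
        nfGen_none]
  cases h with
  | comm i j h =>
    simp only [map_mul, FreeMonoid.lift_eval_of, ← MulOpposite.op_mul]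
    congr 1
    funext s
    change nfGen j (nfGen i s) = nfGen i (nfGen j s)
    rcases h with h | h
    · rw [nfGen_of_two_le (i := j) (by omega), nfGen_of_two_le (i := j) (by omega), nfGen_none]
    · rw [nfGen_of_two_le (i := i) (by omega), nfGen_of_two_le (i := i) (by omega), nfGen_none]
  | braid i j h =>
    simp only [map_mul, FreeMonoid.lift_eval_of, ← MulOpposite.op_mul]
    rcases h with h | h
    · subst h; rw [braid i]
    · subst h; rw [braid j]

/-- The right action of positive braids on normal forms. -/
def nfAct : PosBraid →* (Function.End (Option NF))ᵐᵒᵖ :=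
  PresentedMonoid.lift (fun i => MulOpposite.op (nfGen i)) nfGen_rel

/-- The normal form of `s` times `x`. -/
def nfMul (s : Option NF) (x : PosBraid) : Option NF := (nfAct x).unop s

theorem nfMul_one (s : Option NF) : nfMul s 1 = s := by
  simp [nfMul]; rfl

theorem nfMul_mul (s : Option NF) (x y : PosBraid) : nfMul s (x * y) = nfMul (nfMul s x) y := by
  simp [nfMul]; rfl

theorem nfMul_σ (s : Option NF) (i : ℕ) : nfMul s (σ i) = nfGen i s := rfl

@[elab_as_elim]
theorem posBraid_induction {C : PosBraid → Prop} (one : C 1)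
    (mul : ∀ x i, C x → C (x * σ i)) (x : PosBraid) : C x := by
  induction x using PresentedMonoid.inductionOn with
  | h w =>
    induction w using List.reverseRecOn with
    | nil => exact one
    | append_singleton w i ih => exact mul _ i ih

theorem nfMul_none (x : PosBraid) : nfMul none x = none := by
  induction x using posBraid_induction with
  | one => rw [nfMul_one]
  | mul x i ih => rw [nfMul_mul, ih, nfMul_σ, nfGen_none]

/-! ### Evaluation of normal forms and commutation with Δ₃ -/

theorem Delta_three : Delta 3 = σ 0 * σ 1 * σ 0 := by
  simp [Delta, List.range_succ]

theorem σ_braid : σ 1 * σ 0 * σ 1 = σ 0 * σ 1 * σ 0 :=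
  PresentedMonoid.mk_eq_mk_of_rel (Rel.braid 1 0 (Or.inr rfl))

theorem Delta_mul_σ_zero : Delta 3 * σ 0 = σ 1 * Delta 3 := by
  rw [Delta_three]
  conv_lhs => rw [← σ_braid]
  simp only [mul_assoc]

theorem Delta_mul_σ_one : Delta 3 * σ 1 = σ 0 * Delta 3 := by
  rw [Delta_three]
  conv_rhs => rw [← σ_braid]
  simp only [mul_assoc]

/-- The positive word coded by a list of letters read from right to left. -/
def nfWord (l : List Bool) : PosBraid := (l.reverse.map fun c => σ c.toNat).prod

theorem nfWord_cons (c : Bool) (l : List Bool) : nfWord (c :: l) = nfWord l * σ c.toNat := by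
  simp [nfWord]

theorem nfWord_nil : nfWord [] = 1 := rfl

theorem Delta_mul_σ_not (c : Bool) : Delta 3 * σ (!c).toNat = σ c.toNat * Delta 3 := by
  cases c
  · exact Delta_mul_σ_one
  · exact Delta_mul_σ_zero

theorem nfWord_mul_Delta (l : List Bool) : nfWord l * Delta 3 = Delta 3 * nfWord (l.map not) := by
  induction l with
  | nil => simp [nfWord_nil]
  | cons c l ih =>
    rw [List.map_cons, nfWord_cons, nfWord_cons, ← mul_assoc, ← ih, mul_assoc, mul_assoc,
      Delta_mul_σ_not]

/-- The positive braid with a given normal form. -/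
def nfVal (s : ℕ × List Bool) : PosBraid := Delta 3 ^ s.1 * nfWord s.2

/-- A completed alternating triple is Δ₃, and moving it to the front exchanges the two generators in
the letters it passes; hence the `map not` in `nfStep`. -/
theorem nfVal_nfStep (c : Bool) (s : ℕ × List Bool) :
    nfVal (nfStep c s) = nfVal s * σ c.toNat := by
  obtain ⟨k, l⟩ := s
  match l with
  | [] => simp [nfStep, nfVal, nfWord_cons, mul_assoc]
  | [_] => simp [nfStep, nfVal, nfWord_cons, mul_assoc]
  | y :: x :: l =>
    simp only [nfStep]
    split_ifs with h
    · obtain ⟨h1, rfl⟩ := h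
      have h2 : σ x.toNat * σ y.toNat * σ x.toNat = Delta 3 := by
        cases x <;> cases y <;> simp [σ_braid, Delta_three] at h1 ⊢
      simp only [nfVal, nfWord_cons]
      rw [pow_succ, mul_assoc, ← nfWord_mul_Delta, ← h2]
      simp only [mul_assoc]
    · simp [nfVal, nfWord_cons, mul_assoc]

theorem nfVal_nfMul (x : PosBraid) : ∀ s ∈ nfMul (some ⟨(0, []), trivial⟩) x, nfVal s.1 = x := by
  induction x using posBraid_induction with
  | one =>
    intro s hs
    rw [nfMul_one, Option.mem_some_iff] at hs
    subst hs
    simp [nfVal, nfWord_nil]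
  | mul x i ih =>
    intro s hs
    rw [nfMul_mul, nfMul_σ] at hs
    rcases ht : nfMul (some ⟨(0, []), trivial⟩) x with _ | t
    · rw [ht, nfGen_none] at hs; simp at hs
    have h1 := ih t ht
    rw [ht] at hs
    match i with
    | 0 =>
      rw [nfGen_zero, Option.mem_some_iff] at hs
      subst hs
      exact (nfVal_nfStep false _).trans (by rw [h1]; rfl)
    | 1 =>
      rw [nfGen_one, Option.mem_some_iff] at hs
      subst hs
      exact (nfVal_nfStep true _).trans (by rw [h1]; rfl)
    | i + 2 => rw [nfGen_of_two_le (by omega)] at hs; simp at hs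

/-! ### The number of simple factors -/

/-- The number of simple factors of an alternating-triple-free word. -/
def wordCost : List Bool → ℕ
  | [] => 0
  | [_] => 1
  | x :: y :: l => wordCost (y :: l) + if x = y then 1 else 0

/-- The number of simple factors of a normal form. -/
def nfCost (s : ℕ × List Bool) : ℕ := s.1 + wordCost s.2

theorem wordCost_map_not (l : List Bool) : wordCost (l.map not) = wordCost l := by
  induction l with
  | nil => rfl
  | cons x l ih =>
    cases l with
    | nil => rfl
    | cons y l =>
      simp only [List.map_cons, wordCost] at ih ⊢
      rw [ih]
      simp

theorem wordCost_cons_cons_cons {x y : Bool} {l : List Bool} (hxy : x ≠ y)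
    (h : NoAlternatingTriple (y :: x :: l)) : wordCost (y :: x :: l) = wordCost l + 1 := by
  cases l with
  | nil => simp [wordCost, Ne.symm hxy]
  | cons z l =>
    have : x = z := h.1.resolve_left (Ne.symm hxy)
    subst this
    simp [wordCost, Ne.symm hxy]

/-- When a new Δ₃ is formed, the two letters it absorbs account for exactly one factor, so the total
is unchanged; otherwise a letter is added and the cost cannot drop. -/
theorem nfCost_le_nfStep {s : ℕ × List Bool} (h : NoAlternatingTriple s.2) (c : Bool) :
    nfCost s ≤ nfCost (nfStep c s) := by
  obtain ⟨k, l⟩ := s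
  match l, h with
  | [], _ => simp [nfCost, nfStep, wordCost]
  | [_], _ => simp [nfCost, nfStep, wordCost]
  | y :: x :: l, h =>
    simp only [nfStep]
    split_ifs with h1
    · obtain ⟨h1, rfl⟩ := h1
      simp only [nfCost]
      rw [wordCost_map_not, wordCost_cons_cons_cons (Ne.symm h1) h]
      omega
    · simp [nfCost, wordCost]

theorem nfCost_le_nfMul (s t : NF) (x : PosBraid) (h : nfMul (some s) x = some t) :
    nfCost s.1 ≤ nfCost t.1 := by
  induction x using posBraid_induction generalizing t with
  | one =>
    rw [nfMul_one, Option.some.injEq] at h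
    rw [h]
  | mul x i ih =>
    rw [nfMul_mul, nfMul_σ] at h
    rcases hu : nfMul (some s) x with _ | u
    · rw [hu, nfGen_none] at h; simp at h
    refine (ih u hu).trans ?_
    rw [hu] at h
    match i with
    | 0 =>
      rw [nfGen_zero, Option.some.injEq] at h
      subst h
      exact nfCost_le_nfStep u.2 _
    | 1 =>
      rw [nfGen_one, Option.some.injEq] at h
      subst h
      exact nfCost_le_nfStep u.2 _
    | i + 2 => rw [nfGen_of_two_le (by omega)] at h; simp at h

theorem nfMul_Delta_pow (d : ℕ) :
    nfMul (some ⟨(0, []), trivial⟩) (Delta 3 ^ d) = some ⟨(d, []), trivial⟩ := by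
  induction d with
  | zero => rw [pow_zero, nfMul_one]
  | succ d ih =>
    rw [pow_succ, nfMul_mul, ih, Delta_three, nfMul_mul, nfMul_mul, nfMul_σ, nfMul_σ, nfMul_σ]
    rfl

/-! ### Divisors of Δ₃ ^ d as products of d simple braids -/

open scoped Pointwise

/-- The simple 3-braids. -/
def simples : Set PosBraid := {1, σ 0, σ 1, σ 0 * σ 1, σ 1 * σ 0, Delta 3}

theorem simples_pow_mono {d e : ℕ} (h : d ≤ e) : simples ^ d ⊆ simples ^ e :=
  Set.pow_subset_pow_right (by simp [simples]) h

/-- The cost counts the maximal alternating runs. Without alternating triples such a run has at most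
two letters, so it is a simple braid. -/
theorem nfWord_mem_simples_pow : ∀ l : List Bool, NoAlternatingTriple l →
    nfWord l ∈ simples ^ wordCost l
  | [], _ => by simp [nfWord_nil, wordCost]
  | [x], _ => by
    rw [nfWord_cons, nfWord_nil, one_mul, wordCost, pow_one]
    cases x <;> simp [simples]
  | y :: x :: l, h => by
    by_cases hxy : x = y
    · subst hxy
      rw [nfWord_cons, wordCost, if_pos rfl, pow_succ]
      refine Set.mul_mem_mul (nfWord_mem_simples_pow _ h.tail) ?_
      cases x <;> simp [simples]
    · rw [nfWord_cons, nfWord_cons, wordCost_cons_cons_cons hxy h, pow_succ, mul_assoc]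
      refine Set.mul_mem_mul (nfWord_mem_simples_pow _ h.tail.tail) ?_
      cases x <;> cases y <;> simp [simples] at hxy ⊢

theorem nfVal_mem_simples_pow (s : NF) : nfVal s.1 ∈ simples ^ nfCost s.1 := by
  rw [nfVal, nfCost, pow_add]
  exact Set.mul_mem_mul (Set.pow_mem_pow (by simp [simples])) (nfWord_mem_simples_pow _ s.2)

/-- Since `none` is absorbing and Δ₃ ^ d has a normal form, so does each left divisor, and
monotonicity bounds its cost by d. -/
theorem Div_Delta_pow_subset (d : ℕ) : Div (Delta 3 ^ d) ⊆ simples ^ d := by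
  rintro x ⟨z, hz⟩
  have h := nfMul_Delta_pow d
  rw [hz, nfMul_mul] at h
  rcases hs : nfMul (some ⟨(0, []), trivial⟩) x with _ | s
  · rw [hs, nfMul_none] at h; simp at h
  rw [hs] at h
  have h1 := nfCost_le_nfMul _ _ _ h
  have h2 := nfVal_mem_simples_pow s
  rw [nfVal_nfMul x s hs] at h2
  exact simples_pow_mono h1 h2

theorem exists_mul_eq_Delta {s : PosBraid} (hs : s ∈ simples) :
    ∃ t ∈ simples, s * t = Delta 3 := by
  simp only [simples, Set.mem_insert_iff, Set.mem_singleton_iff] at hs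
  rcases hs with rfl | rfl | rfl | rfl | rfl | rfl
  · exact ⟨Delta 3, by simp [simples], one_mul _⟩
  · exact ⟨σ 1 * σ 0, by simp [simples], by rw [Delta_three, mul_assoc]⟩
  · exact ⟨σ 0 * σ 1, by simp [simples], by rw [Delta_three, ← σ_braid, mul_assoc]⟩
  · exact ⟨σ 0, by simp [simples], by rw [Delta_three]⟩
  · exact ⟨σ 1, by simp [simples], by rw [Delta_three, ← σ_braid]⟩
  · exact ⟨1, by simp [simples], mul_one _⟩

theorem exists_mul_Delta {s : PosBraid} (hs : s ∈ simples) :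
    ∃ t ∈ simples, s * Delta 3 = Delta 3 * t := by
  simp only [simples, Set.mem_insert_iff, Set.mem_singleton_iff] at hs
  rcases hs with rfl | rfl | rfl | rfl | rfl | rfl
  · exact ⟨1, by simp [simples], by simp⟩
  · exact ⟨σ 1, by simp [simples], Delta_mul_σ_one.symm⟩
  · exact ⟨σ 0, by simp [simples], Delta_mul_σ_zero.symm⟩
  · exact ⟨σ 1 * σ 0, by simp [simples], by
      rw [mul_assoc, ← Delta_mul_σ_zero, ← mul_assoc, ← Delta_mul_σ_one, mul_assoc]⟩
  · exact ⟨σ 0 * σ 1, by simp [simples], by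
      rw [mul_assoc, ← Delta_mul_σ_one, ← mul_assoc, ← Delta_mul_σ_zero, mul_assoc]⟩
  · exact ⟨Delta 3, by simp [simples], rfl⟩

theorem exists_mul_Delta_pow (d : ℕ) {s : PosBraid} (hs : s ∈ simples) :
    ∃ t ∈ simples, s * Delta 3 ^ d = Delta 3 ^ d * t := by
  induction d with
  | zero => exact ⟨s, hs, by simp⟩
  | succ d ih =>
    obtain ⟨t, ht, h⟩ := ih
    obtain ⟨u, hu, h'⟩ := exists_mul_Delta ht
    exact ⟨u, hu, by rw [pow_succ, ← mul_assoc, h, mul_assoc, h', mul_assoc]⟩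

/-- Δ₃ ^ d is moved to the left across a simple braid, which becomes another simple braid; the
latter is then completed to one more Δ₃. -/
theorem simples_pow_subset_Div (d : ℕ) : simples ^ d ⊆ Div (Delta 3 ^ d) := by
  induction d with
  | zero =>
    rintro x hx
    rw [pow_zero, Set.mem_one] at hx
    exact ⟨1, by simp [hx]⟩
  | succ d ih =>
    rintro x hx
    rw [pow_succ'] at hx
    obtain ⟨s, hs, y, hy, rfl⟩ := Set.mem_mul.1 hx
    obtain ⟨z, hz⟩ := ih hy
    obtain ⟨t, ht, h⟩ := exists_mul_Delta_pow d hs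
    obtain ⟨u, hu, h'⟩ := exists_mul_eq_Delta ht
    refine ⟨z * u, ?_⟩
    calc Delta 3 ^ (d + 1) = Delta 3 ^ d * t * u := by rw [pow_succ, mul_assoc, h']
      _ = s * Delta 3 ^ d * u := by rw [h]
      _ = s * y * (z * u) := by rw [hz]; simp only [mul_assoc]

theorem Div_Delta_pow (d : ℕ) : Div (Delta 3 ^ d) = simples ^ d :=
  (Div_Delta_pow_subset d).antisymm (simples_pow_subset_Div d)

/-! ### Relations between the braids `δ_{3,p}` -/

/-- The generators `σ 0, σ 1` in alternation. -/
def alt (k : ℕ) : PosBraid := σ (k % 2)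

theorem alt_add_two (k : ℕ) : alt (k + 2) = alt k := by
  simp [alt]

theorem alt_even_or_odd (k : ℕ) :
    (alt k = σ 0 ∧ alt (k + 1) = σ 1) ∨ (alt k = σ 1 ∧ alt (k + 1) = σ 0) := by
  rcases Nat.mod_two_eq_zero_or_one k with h | h
  · left; simp [alt, h, show (k + 1) % 2 = 1 by omega]
  · right; simp [alt, h, show (k + 1) % 2 = 0 by omega]

theorem alt_mul_alt_mul_alt (k : ℕ) : alt k * alt (k + 1) * alt k = Delta 3 := by
  rcases alt_even_or_odd k with ⟨h, h'⟩ | ⟨h, h'⟩ <;> rw [h, h', Delta_three]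
  exact σ_braid

theorem alt_mul_alt_mul_alt' (k : ℕ) : alt (k + 1) * alt k * alt (k + 1) = Delta 3 := by
  rw [← alt_mul_alt_mul_alt (k + 1), alt_add_two]

theorem alt_succ_mul_Delta (k : ℕ) : alt (k + 1) * Delta 3 = Delta 3 * alt k := by
  rcases alt_even_or_odd k with ⟨h, h'⟩ | ⟨h, h'⟩ <;> rw [h, h']
  · exact Delta_mul_σ_zero.symm
  · exact Delta_mul_σ_one.symm

theorem alt_mem_simples (k : ℕ) : alt k ∈ simples := by
  rcases alt_even_or_odd k with ⟨h, -⟩ | ⟨h, -⟩ <;> simp [h, simples]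

theorem alt_mul_alt_mem_simples (k : ℕ) : alt (k + 1) * alt k ∈ simples := by
  rcases alt_even_or_odd k with ⟨h, h'⟩ | ⟨h, h'⟩ <;> simp [h, h', simples]

theorem simples_eq (k : ℕ) :
    simples = {1, alt k, alt (k + 1), alt k * alt (k + 1), alt (k + 1) * alt k, Delta 3} := by
  ext x
  rcases alt_even_or_odd k with ⟨h, h'⟩ | ⟨h, h'⟩ <;> rw [h, h'] <;>
    simp only [simples, Set.mem_insert_iff, Set.mem_singleton_iff]
  tauto

theorem delta_odd (k : ℕ) : delta 3 (2 * k + 1) = alt (k + 1) * delta 3 (2 * k) := by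
  rw [delta, alt]
  congr 2
  simp only [deltaLetter]
  rcases Nat.mod_two_eq_zero_or_one k with h | h
  · rw [show 2 * k % (2 * (3 - 1)) = 0 by omega]; simp; omega
  · rw [show 2 * k % (2 * (3 - 1)) = 2 by omega]; simp; omega

theorem delta_even (k : ℕ) : delta 3 (2 * k + 2) = alt k * delta 3 (2 * k + 1) := by
  rw [delta, alt]
  congr 2
  simp only [deltaLetter]
  rcases Nat.mod_two_eq_zero_or_one k with h | h
  · rw [show (2 * k + 1) % (2 * (3 - 1)) = 1 by omega]; simp; omega
  · rw [show (2 * k + 1) % (2 * (3 - 1)) = 3 by omega]; simp; omega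

theorem delta_even' (k : ℕ) :
    delta 3 (2 * k + 2) = alt k * alt (k + 1) * delta 3 (2 * k) := by
  rw [delta_even, delta_odd, mul_assoc]

/-- This identity, with `Delta_mul_delta`, lets left factors be traded for powers of `σ 0` on the
right; most later computations with δ rest on it. -/
theorem alt_mul_delta (k : ℕ) : alt k * delta 3 (2 * k) = delta 3 (2 * k) * σ 0 := by
  induction k with
  | zero => simp [delta, alt]
  | succ k ih =>
    rw [show 2 * (k + 1) = 2 * k + 2 by ring, delta_even', ← mul_assoc, ← mul_assoc,
      alt_mul_alt_mul_alt', ← alt_mul_alt_mul_alt k, mul_assoc _ (alt k), ih, ← mul_assoc]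

theorem Delta_mul_delta (k : ℕ) : Delta 3 * delta 3 (2 * k) = delta 3 (2 * k + 2) * σ 0 := by
  rw [← alt_mul_alt_mul_alt k, mul_assoc _ (alt k), alt_mul_delta, delta_even', ← mul_assoc]

theorem delta_mul_pow (k : ℕ) : delta 3 (2 * k) * σ 0 ^ k = Delta 3 ^ k := by
  induction k with
  | zero => simp [delta]
  | succ k ih =>
    rw [show 2 * (k + 1) = 2 * k + 2 by ring, pow_succ' (σ 0), ← mul_assoc, ← Delta_mul_delta,
      mul_assoc, ih, pow_succ']

theorem delta_two (i : ℕ) : delta 2 i = σ 0 ^ i := by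
  induction i with
  | zero => rfl
  | succ i ih =>
    have : deltaLetter 2 i = 0 := by
      simp only [deltaLetter]
      have : i % (2 * (2 - 1)) < 2 := Nat.mod_lt _ (by norm_num)
      split_ifs <;> omega
    rw [delta, this, ih, pow_succ']

theorem S₂_eq (d : ℕ) : S₂ d = (List.range (d + 1)).map fun i => σ 0 ^ i := by
  simp only [S₂, S₁, translate, List.map_cons, List.map_nil, mul_one, delta_two]
  exact List.map_eq_flatMap.symm

/-! ### The entries of the sequences -/

/-- The block of the sequence `S₃ d` of rank `k ≥ 1`, lying between the translates of `S₂ d` by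
`δ_{3,2k-2}` and `δ_{3,2k}`. -/
def block (d k : ℕ) : List PosBraid :=
  S₃part d (2 * k - 1) ++ translate (delta 3 (2 * k - 1)) (S₂ d) ++ S₃part d (2 * k)

theorem S₃part_of_lt (d p : ℕ) (hp : p < 2 ∨ 2 * d ≤ p) : S₃part d p = [] := by
  cases d with
  | zero => rfl
  | succ d => rw [S₃part, if_neg (by omega)]

/-- The four residues modulo 4 reduce to the parity of p, with `alt` absorbing the rest: the parts
of rank 2k and 2k + 1 are translates of one and the same block. -/
theorem S₃part_even {d k : ℕ} (h : 1 ≤ k) (h' : k ≤ d) :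
    S₃part (d + 1) (2 * k) = translate (alt k) (block d k) := by
  rw [S₃part, if_pos (by omega), block, alt]
  rcases Nat.mod_two_eq_zero_or_one k with hk | hk
  · rw [if_pos (by omega), hk]
  · rw [if_neg (by omega), if_neg (by omega), if_pos (by omega), hk]

theorem S₃part_odd {d k : ℕ} (h : 1 ≤ k) (h' : k ≤ d) :
    S₃part (d + 1) (2 * k + 1) = translate (alt (k + 1) * alt k) (block d k) := by
  rw [S₃part, if_pos (by omega), block, alt, alt]
  have e1 : 2 * k + 1 - 2 = 2 * k - 1 := by omega
  have e2 : 2 * k + 1 - 1 = 2 * k := by omega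
  rcases Nat.mod_two_eq_zero_or_one k with hk | hk
  · rw [if_neg (by omega), if_pos (by omega), hk, show (k + 1) % 2 = 1 by omega, e1, e2]
  · rw [if_neg (by omega), if_neg (by omega), if_neg (by omega), hk,
      show (k + 1) % 2 = 0 by omega, e1, e2]

/-- The entries of the blocks. -/
inductive InBlock : ℕ → ℕ → PosBraid → Prop
  | mid {d k i : ℕ} (hk : k + 1 ≤ d) (hi : i ≤ d) :
      InBlock d (k + 1) (delta 3 (2 * k + 1) * σ 0 ^ i)
  | low {d k : ℕ} {x : PosBraid} (h : InBlock d k x) :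
      InBlock (d + 1) (k + 1) (alt (k + 1) * alt k * x)
  | high {d k : ℕ} {x : PosBraid} (h : InBlock d k x) : InBlock (d + 1) k (alt k * x)

theorem InBlock.le {d k : ℕ} {x : PosBraid} (h : InBlock d k x) : 1 ≤ k ∧ k ≤ d := by
  induction h <;> omega

theorem mem_translate_delta_S₂ {d p : ℕ} {x : PosBraid} :
    x ∈ translate (delta 3 p) (S₂ d) ↔ ∃ i ≤ d, x = delta 3 p * σ 0 ^ i := by
  simp only [translate, S₂_eq, List.mem_map, List.mem_range, exists_exists_and_eq_and,
    Nat.lt_succ_iff]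
  constructor <;> rintro ⟨i, hi, h⟩ <;> exact ⟨i, hi, h.symm⟩

theorem mem_S₃part {d p : ℕ} {x : PosBraid} : x ∈ S₃part d p ↔ ∃ k, 1 ≤ k ∧ k + 1 ≤ d ∧
    ((p = 2 * k ∧ ∃ y ∈ block (d - 1) k, x = alt k * y) ∨
    (p = 2 * k + 1 ∧ ∃ y ∈ block (d - 1) k, x = alt (k + 1) * alt k * y)) := by
  constructor
  · intro hx
    have hp : ¬ (p < 2 ∨ 2 * d ≤ p) := fun h => by simp [S₃part_of_lt d p h] at hx
    obtain ⟨e, rfl⟩ : ∃ e, d = e + 1 := ⟨d - 1, by omega⟩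
    rcases Nat.even_or_odd' p with ⟨k, rfl | rfl⟩
    · rw [S₃part_even (by omega) (by omega), translate, List.mem_map] at hx
      obtain ⟨y, hy, rfl⟩ := hx
      exact ⟨k, by omega, by omega, Or.inl ⟨rfl, y, hy, rfl⟩⟩
    · rw [S₃part_odd (by omega) (by omega), translate, List.mem_map] at hx
      obtain ⟨y, hy, rfl⟩ := hx
      exact ⟨k, by omega, by omega, Or.inr ⟨rfl, y, hy, rfl⟩⟩
  · rintro ⟨k, hk, hk', h⟩
    obtain ⟨e, rfl⟩ : ∃ e, d = e + 1 := ⟨d - 1, by omega⟩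
    rcases h with ⟨rfl, y, hy, rfl⟩ | ⟨rfl, y, hy, rfl⟩
    · rw [S₃part_even (by omega) (by omega)]; exact List.mem_map_of_mem hy
    · rw [S₃part_odd (by omega) (by omega)]; exact List.mem_map_of_mem hy

theorem mem_block {d k : ℕ} (hk : 1 ≤ k) (hk' : k ≤ d) {x : PosBraid} :
    x ∈ block d k ↔ InBlock d k x := by
  induction d generalizing k x with
  | zero => omega
  | succ d ih =>
    rw [block, List.mem_append, List.mem_append, mem_S₃part, mem_S₃part, mem_translate_delta_S₂,
      Nat.add_sub_cancel]
    constructor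
    · rintro ((⟨j, hj, hj', ⟨h, -⟩ | ⟨h, y, hy, rfl⟩⟩ | ⟨i, hi, rfl⟩) |
        ⟨j, hj, hj', ⟨h, y, hy, rfl⟩ | ⟨h, -⟩⟩)
      · omega
      · obtain rfl : k = j + 1 := by omega
        exact .low ((ih hj (by omega)).1 hy)
      · obtain ⟨j, rfl⟩ : ∃ j, k = j + 1 := ⟨k - 1, by omega⟩
        exact .mid hk' hi
      · obtain rfl : k = j := by omega
        exact .high ((ih hj (by omega)).1 hy)
      · omega
    · intro h
      cases h with
      | @mid _ j i _ hi => exact Or.inl (Or.inr ⟨i, hi, rfl⟩)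
      | @low _ j y h =>
        exact Or.inl (Or.inl ⟨j, h.le.1, by have := h.le.2; omega,
          Or.inr ⟨by omega, y, (ih h.le.1 h.le.2).2 h, rfl⟩⟩)
      | @high _ _ y h =>
        exact Or.inr ⟨k, hk, by have := h.le.2; omega, Or.inl ⟨rfl, y, (ih hk h.le.2).2 h, rfl⟩⟩

theorem mem_S₃ {d : ℕ} {x : PosBraid} : x ∈ S₃ d ↔
    (∃ k ≤ d, ∃ i ≤ d, x = delta 3 (2 * k) * σ 0 ^ i) ∨ ∃ k, InBlock d k x := by
  simp only [S₃, List.mem_append, List.mem_flatMap, List.mem_range]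
  constructor
  · rintro (h | ⟨q, hq, h | h⟩)
    · obtain ⟨i, hi, rfl⟩ := mem_translate_delta_S₂.1 h
      exact Or.inl ⟨0, by omega, i, hi, rfl⟩
    · right
      have hp : ¬ (q + 1 < 2 ∨ 2 * d ≤ q + 1) := fun h' => by simp [S₃part_of_lt _ _ h'] at h
      rcases Nat.even_or_odd' q with ⟨k, rfl | rfl⟩
      · refine ⟨k + 1, (mem_block (by omega) (by omega)).1 ?_⟩
        exact List.mem_append_left _ (List.mem_append_left _ h)
      · refine ⟨k + 1, (mem_block (by omega) (by omega)).1 ?_⟩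
        exact List.mem_append_right _ h
    · rcases Nat.even_or_odd' q with ⟨k, rfl | rfl⟩
      · refine Or.inr ⟨k + 1, (mem_block (by omega) (by omega)).1 ?_⟩
        exact List.mem_append_left _ (List.mem_append_right _ h)
      · obtain ⟨i, hi, rfl⟩ := mem_translate_delta_S₂.1 h
        exact Or.inl ⟨k + 1, by omega, i, hi, rfl⟩
  · rintro (⟨k, hk, i, hi, rfl⟩ | ⟨k, h⟩)
    · cases k with
      | zero => exact Or.inl (mem_translate_delta_S₂.2 ⟨i, hi, rfl⟩)
      | succ k =>
        exact Or.inr ⟨2 * k + 1, by omega, Or.inr (mem_translate_delta_S₂.2 ⟨i, hi, rfl⟩)⟩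
    · obtain ⟨h1, h2⟩ := h.le
      obtain ⟨j, rfl⟩ : ∃ j, k = j + 1 := ⟨k - 1, by omega⟩
      have := (mem_block h1 h2).2 h
      rw [block, List.mem_append, List.mem_append] at this
      rcases this with (h | h) | h
      · exact Or.inr ⟨2 * j, by omega, Or.inl h⟩
      · exact Or.inr ⟨2 * j, by omega, Or.inr h⟩
      · exact Or.inr ⟨2 * j + 1, by omega, Or.inl h⟩

/-! ### The entries are the divisors of `Δ₃ ^ d` -/

theorem InBlock.succ {d k : ℕ} {x : PosBraid} (h : InBlock d k x) : InBlock (d + 1) k x := by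
  induction h with
  | mid hk hi => exact .mid (by omega) (by omega)
  | low _ ih => exact .low ih
  | high _ ih => exact .high ih

/-- Passing Δ₃ through an entry exchanges `alt k` and `alt (k + 1)`, and `Delta_mul_delta` raises
the δ at the end; both match a rise of the rank by one. -/
theorem InBlock.Delta_mul {d k : ℕ} {x : PosBraid} (h : InBlock d k x) :
    InBlock (d + 1) (k + 1) (Delta 3 * x) := by
  induction h with
  | @mid d k i hk hi =>
    have : Delta 3 * (delta 3 (2 * k + 1) * σ 0 ^ i) =
        delta 3 (2 * (k + 1) + 1) * σ 0 ^ (i + 1) := by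
      rw [delta_odd, delta_odd, show 2 * (k + 1) = 2 * k + 2 by ring, ← mul_assoc, ← mul_assoc,
        ← alt_succ_mul_Delta, mul_assoc _ (Delta 3), Delta_mul_delta, pow_succ' (σ 0)]
      simp only [mul_assoc]
    rw [this]
    exact .mid (by omega) (by omega)
  | @low d k x _ ih =>
    have : Delta 3 * (alt (k + 1) * alt k * x) =
        alt (k + 1 + 1) * alt (k + 1) * (Delta 3 * x) := by
      rw [← mul_assoc, ← mul_assoc, ← alt_succ_mul_Delta, mul_assoc _ (Delta 3),
        ← alt_succ_mul_Delta]
      simp only [mul_assoc]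
    rw [this]
    exact .low ih
  | @high d k x _ ih =>
    rw [← mul_assoc, ← alt_succ_mul_Delta, mul_assoc]
    exact .high ih

theorem InBlock.alt_succ_mul {d k : ℕ} {x : PosBraid} (h : InBlock d k x) :
    alt (k + 1) * x ∈ S₃ (d + 1) := by
  rw [mem_S₃]
  cases h with
  | @mid d k i hk hi =>
    refine Or.inl ⟨k + 1, by omega, i, by omega, ?_⟩
    rw [← mul_assoc, alt_add_two, ← delta_even]
    rfl
  | @low d k x h =>
    rw [← mul_assoc, ← mul_assoc, alt_add_two, alt_mul_alt_mul_alt]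
    exact Or.inr ⟨_, h.Delta_mul.succ⟩
  | @high d k x h =>
    rw [← mul_assoc]
    exact Or.inr ⟨_, h.low.succ⟩

theorem InBlock.alt_mul_alt_succ_mul {d k : ℕ} {x : PosBraid} (h : InBlock d k x) :
    alt k * alt (k + 1) * x ∈ S₃ (d + 1) := by
  rw [mem_S₃]
  cases h with
  | @mid d k i hk hi =>
    refine Or.inl ⟨k + 1, by omega, i + 1, by omega, ?_⟩
    rw [alt_add_two, mul_assoc, ← mul_assoc (alt k), ← delta_even, ← mul_assoc,
      show 2 * k + 2 = 2 * (k + 1) by ring, alt_mul_delta, pow_succ', mul_assoc]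
  | @low d k x h =>
    have : alt (k + 1) * alt (k + 1 + 1) * (alt (k + 1) * alt k * x) =
        alt (k + 1) * (Delta 3 * x) := by
      rw [← alt_mul_alt_mul_alt k, alt_add_two]
      simp only [mul_assoc]
    rw [this]
    exact Or.inr ⟨_, h.Delta_mul.high⟩
  | @high d k x h =>
    rw [← mul_assoc, alt_mul_alt_mul_alt]
    exact Or.inr ⟨_, h.Delta_mul.succ⟩

/-- The simple braids are listed relative to the parity of the rank k, so that one computation
serves for both parities. Each product is either a constructor of `InBlock` or falls under the
identities for δ and Δ₃. -/
theorem simples_mul_S₃ {d : ℕ} {s x : PosBraid} (hs : s ∈ simples) (hx : x ∈ S₃ d) :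
    s * x ∈ S₃ (d + 1) := by
  rcases mem_S₃.1 hx with ⟨k, hk, i, hi, rfl⟩ | ⟨k, h⟩
  · rw [simples_eq k] at hs
    rw [← mul_assoc]
    simp only [Set.mem_insert_iff, Set.mem_singleton_iff] at hs
    rcases hs with rfl | rfl | rfl | rfl | rfl | rfl
    · exact mem_S₃.2 (Or.inl ⟨k, by omega, i, by omega, by rw [one_mul]⟩)
    · exact mem_S₃.2 (Or.inl ⟨k, by omega, i + 1, by omega, by
        rw [alt_mul_delta, pow_succ', mul_assoc]⟩)
    · rw [← delta_odd]
      exact mem_S₃.2 (Or.inr ⟨_, .mid (by omega) (by omega)⟩)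
    · rw [← delta_even']
      exact mem_S₃.2 (Or.inl ⟨k + 1, by omega, i, by omega, rfl⟩)
    · rw [mul_assoc (alt (k + 1)), alt_mul_delta, ← mul_assoc, ← delta_odd, mul_assoc, ← pow_succ']
      exact mem_S₃.2 (Or.inr ⟨_, .mid (by omega) (by omega)⟩)
    · rw [Delta_mul_delta, mul_assoc, ← pow_succ']
      exact mem_S₃.2 (Or.inl ⟨k + 1, by omega, i + 1, by omega, rfl⟩)
  · rw [simples_eq k] at hs
    simp only [Set.mem_insert_iff, Set.mem_singleton_iff] at hs
    rcases hs with rfl | rfl | rfl | rfl | rfl | rfl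
    · rw [one_mul]; exact mem_S₃.2 (Or.inr ⟨_, h.succ⟩)
    · exact mem_S₃.2 (Or.inr ⟨_, h.high⟩)
    · exact h.alt_succ_mul
    · exact h.alt_mul_alt_succ_mul
    · exact mem_S₃.2 (Or.inr ⟨_, h.low⟩)
    · exact mem_S₃.2 (Or.inr ⟨_, h.Delta_mul⟩)

theorem simples_pow_subset_S₃ (d : ℕ) : ∀ x ∈ simples ^ d, x ∈ S₃ d := by
  induction d with
  | zero =>
    intro x hx
    rw [pow_zero, Set.mem_one] at hx
    exact mem_S₃.2 (Or.inl ⟨0, le_rfl, 0, le_rfl, by simp [hx, delta]⟩)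
  | succ d ih =>
    intro x hx
    rw [pow_succ'] at hx
    obtain ⟨s, hs, y, hy, rfl⟩ := Set.mem_mul.1 hx
    exact simples_mul_S₃ hs (ih y hy)

theorem mul_mem_simples_pow {d e : ℕ} {s x : PosBraid} (hs : s ∈ simples) (hx : x ∈ simples ^ d)
    (h : d + 1 ≤ e) : s * x ∈ simples ^ e :=
  simples_pow_mono h (by rw [pow_succ']; exact Set.mul_mem_mul hs hx)

theorem alt_succ_mul_alt_mul_delta (k : ℕ) :
    alt (k + 1) * alt k * delta 3 (2 * k) = delta 3 (2 * k + 1) * σ 0 := by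
  rw [mul_assoc, alt_mul_delta, ← mul_assoc, delta_odd]

/-- By `Delta_mul_delta` one factor Δ₃ lowers k and i together, which gives the maximum rather than
the sum. -/
theorem delta_even_mul_pow_mem (k i : ℕ) :
    delta 3 (2 * k) * σ 0 ^ i ∈ simples ^ max k i := by
  induction k generalizing i with
  | zero =>
    simp only [delta, one_mul, zero_le, max_eq_right]
    exact Set.pow_mem_pow (by simp [simples])
  | succ k ih =>
    rcases i with _ | i
    · rw [show 2 * (k + 1) = 2 * k + 2 by ring, delta_even', mul_assoc]
      refine mul_mem_simples_pow ?_ (ih 0) (by simp)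
      have := alt_mul_alt_mem_simples (k + 1)
      rwa [alt_add_two] at this
    · rw [show 2 * (k + 1) = 2 * k + 2 by ring, pow_succ', ← mul_assoc, ← Delta_mul_delta,
        mul_assoc]
      exact mul_mem_simples_pow (by simp [simples]) (ih i) (by omega)

theorem delta_odd_mul_pow_mem (k i : ℕ) :
    delta 3 (2 * k + 1) * σ 0 ^ i ∈ simples ^ max (k + 1) i := by
  rcases i with _ | i
  · rw [delta_odd, mul_assoc]
    exact mul_mem_simples_pow (alt_mem_simples _) (delta_even_mul_pow_mem k 0) (by simp)
  · rw [pow_succ', ← mul_assoc, ← alt_succ_mul_alt_mul_delta, mul_assoc _ (delta _ _)]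
    exact mul_mem_simples_pow (alt_mul_alt_mem_simples k) (delta_even_mul_pow_mem k i) (by omega)

theorem InBlock.mem_simples_pow {d k : ℕ} {x : PosBraid} (h : InBlock d k x) :
    x ∈ simples ^ d := by
  induction h with
  | mid hk hi => exact simples_pow_mono (max_le hk hi) (delta_odd_mul_pow_mem _ _)
  | low _ ih => exact mul_mem_simples_pow (alt_mul_alt_mem_simples _) ih le_rfl
  | high _ ih => exact mul_mem_simples_pow (alt_mem_simples _) ih le_rfl

theorem mem_S₃_iff_mem_Div {d : ℕ} {x : PosBraid} : x ∈ S₃ d ↔ x ∈ Div (Delta 3 ^ d) := by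
  rw [Div_Delta_pow]
  refine ⟨fun h => ?_, simples_pow_subset_S₃ d x⟩
  rcases mem_S₃.1 h with ⟨k, hk, i, hi, rfl⟩ | ⟨k, h⟩
  · exact simples_pow_mono (max_le hk hi) (delta_even_mul_pow_mem k i)
  · exact h.mem_simples_pow

/-! ### Comparison by braids that are `σ 1`-positive -/

/-- `x⁻¹ y` is represented by a word in the letters `σ 0, σ 1` and their inverses that contains
`σ 1` and does not contain its inverse. -/
def SigmaOneLt (x y : PosBraid) : Prop :=
  ∃ w : List (ℕ × Bool), ((1, true) ∈ w ∧ (1, false) ∉ w ∧ ∀ l ∈ w, l.1 ≤ 1) ∧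
    wordBraid w = (toBraid x)⁻¹ * toBraid y

theorem SigmaOneLt.posLt {x y : PosBraid} (h : SigmaOneLt x y) : PosLt x y := by
  obtain ⟨w, hw, h⟩ := h
  exact ⟨w, ⟨1, hw⟩, h⟩

theorem SigmaOneLt.trans {x y z : PosBraid} (h : SigmaOneLt x y) (k : SigmaOneLt y z) :
    SigmaOneLt x z := by
  obtain ⟨v, ⟨v1, v2, v3⟩, h⟩ := h
  obtain ⟨w, ⟨w1, w2, w3⟩, k⟩ := k
  refine ⟨v ++ w, ⟨by simp [v1], by simp [v2, w2], fun l hl => ?_⟩, ?_⟩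
  · rcases List.mem_append.1 hl with hl | hl
    · exact v3 l hl
    · exact w3 l hl
  · rw [wordBraid_append, h, k]; group

theorem SigmaOneLt.mul_left {x y : PosBraid} (h : SigmaOneLt x y) (z : PosBraid) :
    SigmaOneLt (z * x) (z * y) := by
  obtain ⟨w, hw, h⟩ := h
  exact ⟨w, hw, by rw [h, map_mul, map_mul]; group⟩

theorem PosLt.mul_left {x y : PosBraid} (h : PosLt x y) (z : PosBraid) :
    PosLt (z * x) (z * y) := by
  obtain ⟨w, hw, h⟩ := h
  exact ⟨w, hw, by rw [h, map_mul, map_mul]; group⟩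

theorem wordBraid_replicate_true (n i : ℕ) :
    wordBraid (List.replicate n (i, true)) = toBraid (σ i ^ n) := by
  simp [wordBraid, toBraid, σ]

theorem wordBraid_replicate_false (n i : ℕ) :
    wordBraid (List.replicate n (i, false)) = (toBraid (σ i ^ n))⁻¹ := by
  simp [wordBraid, toBraid, σ]

theorem SigmaOneLt.of_words {x y x' y' : PosBraid} (h : SigmaOneLt x y) {u v : List (ℕ × Bool)}
    (hu : ∀ l ∈ u, l.1 = 0) (hv : ∀ l ∈ v, l.1 = 0)
    (hx : wordBraid u = (toBraid x')⁻¹ * toBraid x)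
    (hy : wordBraid v = (toBraid y)⁻¹ * toBraid y') : SigmaOneLt x' y' := by
  obtain ⟨w, ⟨w1, w2, w3⟩, h⟩ := h
  refine ⟨u ++ w ++ v, ⟨by simp [w1], ?_, fun l hl => ?_⟩, ?_⟩
  · simp only [List.mem_append, not_or]
    exact ⟨⟨fun h => by simpa using hu _ h, w2⟩, fun h => by simpa using hv _ h⟩
  · simp only [List.mem_append] at hl
    rcases hl with (hl | hl) | hl
    · simp [hu l hl]
    · exact w3 l hl
    · simp [hv l hl]
  · rw [wordBraid_append, wordBraid_append, h, hx, hy]; group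

/-- This invariance fails for `PosLt`. It reduces comparisons between translates of `S₂` to
comparisons between the δ's. -/
theorem SigmaOneLt.mul_pow {x y : PosBraid} (h : SigmaOneLt x y) (i j : ℕ) :
    SigmaOneLt (x * σ 0 ^ i) (y * σ 0 ^ j) :=
  h.of_words (u := List.replicate i (0, false)) (v := List.replicate j (0, true))
    (fun l hl => by rw [List.eq_of_mem_replicate hl])
    (fun l hl => by rw [List.eq_of_mem_replicate hl])
    (by rw [wordBraid_replicate_false, map_mul]; group)
    (by rw [wordBraid_replicate_true, map_mul]; group)

theorem SigmaOneLt.of_mul_pow {x y : PosBraid} {i j : ℕ}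
    (h : SigmaOneLt (x * σ 0 ^ i) (y * σ 0 ^ j)) : SigmaOneLt x y :=
  h.of_words (u := List.replicate i (0, true)) (v := List.replicate j (0, false))
    (fun l hl => by rw [List.eq_of_mem_replicate hl])
    (fun l hl => by rw [List.eq_of_mem_replicate hl])
    (by rw [wordBraid_replicate_true, map_mul]; group)
    (by rw [wordBraid_replicate_false, map_mul]; group)

theorem SigmaOneLt.of_mul_σ_zero {x y : PosBraid} (h : SigmaOneLt x (y * σ 0)) :
    SigmaOneLt x y := by
  apply SigmaOneLt.of_mul_pow (i := 0) (j := 1)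
  simpa using h

theorem sigmaOneLt_mul_σ_one (x : PosBraid) : SigmaOneLt x (x * σ 1) :=
  ⟨[(1, true)], by simp, by rw [map_mul]; simp [wordBraid, toBraid, σ]⟩

theorem alt_succ_mul_Delta_pow (k : ℕ) : alt (k + 1) * Delta 3 ^ k = Delta 3 ^ k * σ 1 := by
  induction k with
  | zero => simp [alt]
  | succ k ih =>
    rw [pow_succ', ← mul_assoc, alt_succ_mul_Delta, mul_assoc, ih, mul_assoc]

/-- The exponent of `σ 0` is chosen by `delta_mul_pow` to turn the even-indexed δ into a power of
Δ₃; the two sides then differ by a right factor `σ 1`. -/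
theorem sigmaOneLt_delta_succ (p : ℕ) : SigmaOneLt (delta 3 p) (delta 3 (p + 1)) := by
  rcases Nat.even_or_odd' p with ⟨k, rfl | rfl⟩
  · apply SigmaOneLt.of_mul_pow (i := k) (j := k)
    rw [delta_odd, mul_assoc, delta_mul_pow, alt_succ_mul_Delta_pow]
    exact sigmaOneLt_mul_σ_one _
  · apply SigmaOneLt.of_mul_pow (i := k + 1) (j := k + 1)
    have h1 : delta 3 (2 * k + 1) * σ 0 ^ (k + 1) = alt (k + 1) * alt k * Delta 3 ^ k := by
      rw [pow_succ', ← mul_assoc, ← alt_succ_mul_alt_mul_delta, mul_assoc _ (delta _ _),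
        delta_mul_pow]
    have h2 : delta 3 (2 * k + 1 + 1) * σ 0 ^ (k + 1) =
        alt (k + 1) * alt k * Delta 3 ^ k * σ 1 := by
      rw [mul_assoc _ _ (σ 1), ← alt_succ_mul_Delta_pow, ← mul_assoc, alt_mul_alt_mul_alt',
        ← pow_succ', ← delta_mul_pow]
      rfl
    rw [h1, h2]
    exact sigmaOneLt_mul_σ_one _

theorem sigmaOneLt_delta {p q : ℕ} (h : p < q) : SigmaOneLt (delta 3 p) (delta 3 q) := by
  induction q, h using Nat.le_induction with
  | base => exact sigmaOneLt_delta_succ p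
  | succ q _ ih => exact ih.trans (sigmaOneLt_delta_succ q)

/-! ### Bounds for the entries -/

/-- Left multiplication carries the lower bound to the next δ and the upper bound to δ_{2k+2} `σ 0`,
whose last factor can be dropped. The next lemma does the same with two letters. -/
theorem sigmaOneLt_alt_mul {k : ℕ} {y : PosBraid} (h : SigmaOneLt (delta 3 (2 * k)) y)
    (h' : SigmaOneLt y (delta 3 (2 * k + 2))) :
    SigmaOneLt (delta 3 (2 * k + 1)) (alt (k + 1) * y) ∧
      SigmaOneLt (alt (k + 1) * y) (delta 3 (2 * k + 2)) := by
  constructor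
  · rw [delta_odd]; exact h.mul_left _
  · have := h'.mul_left (alt (k + 1))
    rw [show 2 * k + 2 = 2 * (k + 1) by ring, alt_mul_delta] at this
    exact this.of_mul_σ_zero

theorem sigmaOneLt_alt_mul_alt_mul {k : ℕ} {y : PosBraid}
    (h : SigmaOneLt (delta 3 (2 * k)) y) (h' : SigmaOneLt y (delta 3 (2 * k + 2))) :
    SigmaOneLt (delta 3 (2 * k + 2)) (alt (k + 1 + 1) * alt (k + 1) * y) ∧
      SigmaOneLt (alt (k + 1 + 1) * alt (k + 1) * y) (delta 3 (2 * k + 3)) := by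
  constructor
  · rw [delta_even', alt_add_two]; exact h.mul_left _
  · have := h'.mul_left (alt (k + 1 + 1) * alt (k + 1))
    rw [show 2 * k + 2 = 2 * (k + 1) by ring, alt_succ_mul_alt_mul_delta] at this
    exact this.of_mul_σ_zero

theorem InBlock.sigmaOneLt {d k : ℕ} {x : PosBraid} (h : InBlock d (k + 1) x) :
    SigmaOneLt (delta 3 (2 * k)) x ∧ SigmaOneLt x (delta 3 (2 * k + 2)) := by
  induction d generalizing k x with
  | zero => have := h.le; omega
  | succ d ih =>
    cases h with
    | @mid _ _ i hk hi =>
      have h1 := (sigmaOneLt_delta (Nat.lt_succ_self (2 * k))).mul_pow 0 i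
      have h2 := (sigmaOneLt_delta (Nat.lt_succ_self (2 * k + 1))).mul_pow i 0
      rw [pow_zero, mul_one] at h1 h2
      exact ⟨h1, h2⟩
    | @low _ _ y h =>
      obtain ⟨j, rfl⟩ : ∃ j, k = j + 1 := ⟨k - 1, by have := h.le; omega⟩
      have := sigmaOneLt_alt_mul_alt_mul (ih h).1 (ih h).2
      exact ⟨this.1, this.2.trans (sigmaOneLt_delta_succ _)⟩
    | @high _ _ y h =>
      have := sigmaOneLt_alt_mul (ih h).1 (ih h).2
      exact ⟨(sigmaOneLt_delta_succ _).trans this.1, this.2⟩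

theorem sigmaOneLt_of_mem_S₃part {d p : ℕ} {x : PosBraid} (h : x ∈ S₃part d (p + 1)) :
    SigmaOneLt (delta 3 p) x ∧ SigmaOneLt x (delta 3 (p + 1)) := by
  obtain ⟨k, hk, hk', h⟩ := mem_S₃part.1 h
  obtain ⟨j, rfl⟩ : ∃ j, k = j + 1 := ⟨k - 1, by omega⟩
  rcases h with ⟨hp, y, hy, rfl⟩ | ⟨hp, y, hy, rfl⟩
  · obtain rfl : p = 2 * j + 1 := by omega
    have := ((mem_block (by omega) (by omega)).1 hy).sigmaOneLt
    exact sigmaOneLt_alt_mul this.1 this.2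
  · obtain rfl : p = 2 * j + 2 := by omega
    have := ((mem_block (by omega) (by omega)).1 hy).sigmaOneLt
    exact sigmaOneLt_alt_mul_alt_mul this.1 this.2

/-! ### The sequences are increasing -/

theorem pairwise_translate {S : List PosBraid} (h : S.Pairwise PosLt) (x : PosBraid) :
    (translate x S).Pairwise PosLt :=
  List.pairwise_map.2 (h.imp fun h => h.mul_left x)

theorem posLt_σ_zero_pow {i j : ℕ} (h : i < j) : PosLt (σ 0 ^ i) (σ 0 ^ j) := by
  obtain ⟨m, rfl⟩ := Nat.exists_eq_add_of_lt h
  refine ⟨List.replicate (m + 1) (0, true), ⟨0, by simp, by simp, fun l hl => ?_⟩, ?_⟩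
  · rw [List.eq_of_mem_replicate hl]
  · rw [wordBraid_replicate_true, eq_inv_mul_iff_mul_eq, ← map_mul, ← pow_add, add_assoc]

theorem pairwise_S₂ (d : ℕ) : (S₂ d).Pairwise PosLt := by
  rw [S₂_eq]
  exact List.pairwise_map.2 (List.pairwise_lt_range.imp posLt_σ_zero_pow)

theorem pairwise_segment {d p : ℕ} (h : (S₃part d (p + 1)).Pairwise PosLt) :
    (S₃part d (p + 1) ++ translate (delta 3 (p + 1)) (S₂ d)).Pairwise PosLt := by
  refine List.pairwise_append.2 ⟨h, pairwise_translate (pairwise_S₂ d) _, fun x hx y hy => ?_⟩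
  obtain ⟨i, -, rfl⟩ := mem_translate_delta_S₂.1 hy
  have := (sigmaOneLt_of_mem_S₃part hx).2.mul_pow 0 i
  rw [pow_zero, mul_one] at this
  exact this.posLt

/-- No upper bound by δ_{p+1} itself is possible, as the segment contains its multiples by powers of
`σ 0`; the second clause bounds the segment by whatever lies `SigmaOneLt`-above δ_{p+1}. -/
theorem sigmaOneLt_of_mem_segment {d p : ℕ} {x : PosBraid}
    (h : x ∈ S₃part d (p + 1) ++ translate (delta 3 (p + 1)) (S₂ d)) :
    SigmaOneLt (delta 3 p) x ∧ ∀ y, SigmaOneLt (delta 3 (p + 1)) y → SigmaOneLt x y := by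
  rcases List.mem_append.1 h with h | h
  · have := sigmaOneLt_of_mem_S₃part h
    exact ⟨this.1, fun y hy => this.2.trans hy⟩
  · obtain ⟨i, -, rfl⟩ := mem_translate_delta_S₂.1 h
    constructor
    · have := (sigmaOneLt_delta_succ p).mul_pow 0 i
      rwa [pow_zero, mul_one] at this
    · intro y hy
      have := hy.mul_pow i 0
      rwa [pow_zero, mul_one] at this

theorem pairwise_S₃part (d p : ℕ) : (S₃part d p).Pairwise PosLt := by
  induction d generalizing p with
  | zero => exact List.Pairwise.nil
  | succ d ih =>
    by_cases hp : p < 2 ∨ 2 * (d + 1) ≤ p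
    · rw [S₃part_of_lt _ _ hp]; exact List.Pairwise.nil
    have hblock : ∀ k, 1 ≤ k → (block d k).Pairwise PosLt := by
      intro k hk
      obtain ⟨j, rfl⟩ : ∃ j, k = j + 1 := ⟨k - 1, by omega⟩
      refine List.pairwise_append.2 ⟨pairwise_segment (p := 2 * j) (ih _), ih _,
        fun x hx y hy => ?_⟩
      exact ((sigmaOneLt_of_mem_segment (p := 2 * j) hx).2 y
        (sigmaOneLt_of_mem_S₃part (p := 2 * j + 1) hy).1).posLt
    rcases Nat.even_or_odd' p with ⟨k, rfl | rfl⟩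
    · rw [S₃part_even (by omega) (by omega)]
      exact pairwise_translate (hblock k (by omega)) _
    · rw [S₃part_odd (by omega) (by omega)]
      exact pairwise_translate (hblock k (by omega)) _

theorem pairwise_S₃ (d : ℕ) : (S₃ d).Pairwise PosLt := by
  refine List.pairwise_append.2 ⟨pairwise_translate (pairwise_S₂ d) _,
    List.pairwise_flatMap.2 ⟨fun q _ => pairwise_segment (pairwise_S₃part d _),
      List.pairwise_lt_range.imp fun {p q} hpq x hx y hy => ?_⟩, fun x hx y hy => ?_⟩
  · refine ((sigmaOneLt_of_mem_segment hx).2 y ?_).posLt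
    rcases Nat.eq_or_lt_of_le (Nat.succ_le_of_lt hpq) with h | h
    · obtain rfl : p + 1 = q := h
      exact (sigmaOneLt_of_mem_segment hy).1
    · exact (sigmaOneLt_delta h).trans (sigmaOneLt_of_mem_segment hy).1
  · obtain ⟨i, -, rfl⟩ := mem_translate_delta_S₂.1 hx
    obtain ⟨q, -, hy⟩ := List.mem_flatMap.1 hy
    have h1 := (sigmaOneLt_of_mem_segment hy).1
    have h2 : SigmaOneLt (delta 3 0) y := by
      rcases Nat.eq_zero_or_pos q with rfl | hq
      · exact h1
      · exact (sigmaOneLt_delta hq).trans h1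
    have := h2.mul_pow i 0
    rw [pow_zero, mul_one] at this
    exact this.posLt

end BraidOrder

theorem proposition4p7 (d : ℕ) :
    BraidOrder.IsIncreasingEnumeration BraidOrder.PosLt (BraidOrder.S₃ d)
      (BraidOrder.Div (BraidOrder.Delta 3 ^ d)) := by
  have hlt : ∀ i j : Fin (BraidOrder.S₃ d).length, i < j →
      BraidOrder.PosLt ((BraidOrder.S₃ d).get i) ((BraidOrder.S₃ d).get j) :=
    fun i j h => List.pairwise_iff_get.1 (BraidOrder.pairwise_S₃ d) i j h
  refine ⟨fun x => BraidOrder.mem_S₃_iff_mem_Div, fun i j => ⟨fun h => ?_, hlt i j⟩⟩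
  -- Since the sequence is increasing, a comparison against the order of positions would yield x <
  -- x.
  by_contra hij
  rcases (not_lt.1 hij).eq_or_lt with rfl | hji
  · exact BraidOrder.Lt.irrefl _ h
  · exact BraidOrder.Lt.irrefl _ (BraidOrder.Lt.trans h (hlt j i hji))
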